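/- Let $d\in\mathbb N$, $\lambda>0$, $s>0$. Let $(e_j)_{j\ge1}$ be i.i.d. standard exponential random variables and let $(Z^{(i)})_{i\ge1}$ be i.i.d. $\mathbb R^d$-valued random variables, independent of $(e_j)$, with $\mathbb P(Z^{(1)}=0)=0$. Put $N(t)=\max\{n\ge0:\sum_{j=1}^n e_j\le\lambda t\}$ and let $$X(t)=\sum_{i=1}^{N(t)}Z^{(i)},\qquad t\in[0,1),$$ be the corresponding compound Poisson process, viewed as a random element of the space $\mathbf D([0,1),\mathbb R^d)$ of right-continuous piecewise constant functions $[0,1)\to\mathbb R^d$ with finitely many jumps. Let $\rho_{\mathbf D}(f,g)=\int_0^1\|f(t)-g(t)\|_\infty\,dt$, where $\|x\|_\infty=\max_i|x_i|$. For a random variable $Y$ in a space $E$ with distortion $\rho$ and for $r\ge 0$, let $$D^{(q)}(r\,|\,Y,\rho,s)=\inf\Big\{\big(\mathbb E\min_{a\in\mathcal C}\rho(Y,a)^s\big)^{1/s}:\ \emptyset\ne\mathcal C\subseteq E\text{ finite},\ \log\#\mathcal C\le r\Big\}\in[0,\infty]$$ and, for $\varepsilon>0$, $$d^{(q)}(\varepsilon\,|\,Y,\rho,s)=\inf\{n\in\mathbb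 N,\ n\ge1:\ D^{(q)}(\log n\,|\,Y,\rho,s)\le\varepsilon\}\in\mathbb N\cup\{\infty\},$$ with the conventions $\log\infty=\infty$, $\log 0=-\infty$. Assume that the law of $Z^{(1)}$ has an absolutely continuous component, i.e. that it dominates a nonzero measure that is absolutely continuous with respect to Lebesgue measure on $\mathbb R^d$. Then $$\limsup_{r\to\infty}\ \frac{-\log D^{(q)}(r\,|\,X,\rho_{\mathbf D},s)}{\sqrt{\frac{2}{s(1+d)}\,r\log r}}\ \le\ 1 .$$ If in addition $$\limsup_{\varepsilon\downarrow0}\frac{\log d^{(q)}(\varepsilon\,|\,Z^{(1)},\|\cdot\|_\infty,s)}{\log(1/\varepsilon)}=d,$$ where $\|\cdot\|_\infty$ stands for the distortion $(x,y)\mapsto\|x-y\|_\infty$ on $\mathbb R^d$, then $$\lim_{r\to\infty}\ \frac{-\log D^{(q)}(r\,|\,X,\rho_{\mathbf D},s)}{\sqrt{\frac{2}{s(1+d)}\,r\log r}}\ =\ 1 .$$ -/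

import Mathlib

open Filter Topology MeasureTheory ProbabilityTheory
open scoped ENNReal

noncomputable section

/-- The quantization error `D^(q)(r | X, ρ, s)`: the infimum, over all nonempty finite codebooks
`C ⊆ E` with `log #C ≤ r`, of `(𝔼 min_{a ∈ C} ρ(X, a)^s)^(1/s)`. It is `∞` if no codebook has
finite error. -/
def quantError {Ω E : Type*} [MeasurableSpace Ω] (P : Measure Ω) (X : Ω → E)
    (ρ : E → E → ℝ≥0∞) (s r : ℝ) : ℝ≥0∞ :=
  ⨅ (C : Finset E) (_ : C.Nonempty) (_ : Real.log (C.card : ℝ) ≤ r),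
    (∫⁻ ω, ⨅ a ∈ C, ρ (X ω) a ^ s ∂P) ^ (1 / s)

/-- `d^(q)(ε | X, ρ, s)`: the least `n ≥ 1` with `D^(q)(log n | X, ρ, s) ≤ ε`
(`∞` if there is none). -/
def quantNumber {Ω E : Type*} [MeasurableSpace Ω] (P : Measure Ω) (X : Ω → E)
    (ρ : E → E → ℝ≥0∞) (s ε : ℝ) : ℕ∞ :=
  ⨅ (n : ℕ) (_ : 1 ≤ n) (_ : quantError P X ρ s (Real.log (n : ℝ)) ≤ ENNReal.ofReal ε), (n : ℕ∞)

/-- The (upper) quantization dimension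
`γ = limsup_{ε → 0+} log d^(q)(ε | X, ρ, s) / log (1/ε)`, an extended real number. -/
def quantDim {Ω E : Type*} [MeasurableSpace Ω] (P : Measure Ω) (X : Ω → E)
    (ρ : E → E → ℝ≥0∞) (s : ℝ) : EReal :=
  limsup (fun ε : ℝ => ENNReal.log (quantNumber P X ρ s ε : ℝ≥0∞) /
    ((Real.log (1 / ε) : ℝ) : EReal)) (𝓝[>] 0)

/-- The distortion `ρ(x, y) = ‖x - y‖`. On `Fin d → ℝ` the norm is the maximum norm. -/
def normDist {E : Type*} [NormedAddCommGroup E] (x y : E) : ℝ≥0∞ := ‖x - y‖ₑ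

/-- The space `𝔻([0,1[, E)` of piecewise constant functions `[0,1[ → E` with finitely many jumps,
taking the new value at each jump: there is a finite set `F` of times such that `f` does not change
between `x` and `y` as long as no time of `F` lies in `]x, y]`. -/
def StepPath (E : Type*) : Type _ :=
  {f : Set.Ico (0 : ℝ) 1 → E //
    ∃ F : Finset ℝ, ∀ x y : Set.Ico (0 : ℝ) 1, x ≤ y →
      (∀ u ∈ F, ¬ ((x : ℝ) < u ∧ u ≤ (y : ℝ))) → f x = f y}

/-- The `σ`-field on the path space induced by the projections `f ↦ f t`. -/
instance StepPath.instMeasurableSpace (E : Type*) [MeasurableSpace E] :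
    MeasurableSpace (StepPath E) :=
  MeasurableSpace.comap (fun f : StepPath E => f.1) inferInstance

/-- The distortion `ρ_𝔻(f, g) = ∫_0^1 ‖f(t) - g(t)‖ dt` on the path space,
integrating against Lebesgue measure on `[0,1[`. -/
def pathDist {E : Type*} [NormedAddCommGroup E] (f g : StepPath E) : ℝ≥0∞ :=
  ∫⁻ t : Set.Ico (0 : ℝ) 1, normDist (f.1 t) (g.1 t) ∂(Measure.comap Subtype.val volume)

/-- `N(t) = max {n ≥ 0 : e_1 + ... + e_n ≤ lam * t}` (the sequence is indexed from `0` here). -/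
def countingProcess {Ω : Type*} (lam : ℝ) (e : ℕ → Ω → ℝ) (t : ℝ) (ω : Ω) : ℕ :=
  sSup {n : ℕ | ∑ i ∈ Finset.range n, e i ω ≤ lam * t}

/-- `X` is the compound Poisson process `X(t) = Z_1 + ... + Z_{N(t)}`, `t ∈ [0,1[`, where `N` is the
Poisson process with intensity `lam` built from the i.i.d. standard exponential variables `e`, and
where `Z` is an i.i.d. sequence independent of `e`, not charging `0`. -/
structure IsCompoundPoisson {Ω E : Type*} [MeasurableSpace Ω] [NormedAddCommGroup E]
    [MeasurableSpace E] (P : Measure Ω) (lam : ℝ) (e : ℕ → Ω → ℝ) (Z : ℕ → Ω → E)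
    (X : Ω → StepPath E) : Prop where
  measurable_e : ∀ i, Measurable (e i)
  law_e : ∀ i, P.map (e i) = expMeasure 1
  iIndep_e : iIndepFun e P
  measurable_Z : ∀ i, Measurable (Z i)
  identDistrib_Z : ∀ i, IdentDistrib (Z i) (Z 0) P P
  iIndep_Z : iIndepFun Z P
  indep_e_Z : IndepFun (fun ω i => e i ω) (fun ω i => Z i ω) P
  Z_ne_zero : P {ω | Z 0 ω = 0} = 0
  measurable_X : Measurable X
  X_eq : ∀ᵐ ω ∂P, ∀ t : Set.Ico (0 : ℝ) 1,
    (X ω).1 t = ∑ i ∈ Finset.range (countingProcess lam e (t : ℝ) ω), Z i ω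

/-- The measure `μ` has an absolutely continuous component with respect to Lebesgue measure. -/
def HasACComponent {d : ℕ} (μ : Measure (Fin d → ℝ)) : Prop :=
  ∃ ν : Measure (Fin d → ℝ), ν ≠ 0 ∧ ν ≤ μ ∧ ν ≪ volume

end

/-! A path with `n` jumps has `1 + d` real parameters per jump: a time and a height. Having about
`n` jumps costs a probability `exp (-n log n)` up to factors exponential in `n`. With `exp r`
codewords, the parameters of such paths can be resolved to a precision `ε` with `log (1/ε)` about `r
/ ((1 + d) n)`, and no better. The `n`-jump paths thus contribute about `exp (-(n log n + s r / ((1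
+ d) n)))` to the `s`-th power of the error. The exponent is smallest for `n` about `√(2s/(1 + d))
√(r / log r)`, where `log n` is about `log r / 2` and the exponent is about `√(2s/(1 + d)) √(r log
r)`. Dividing by `s` gives the stated rate.

For the limsup, this critical `n` alone suffices. On an event of probability at least `(c/n)^n` the
jumps are well separated and not small, and the heights lie in a set where their law has bounded
density. Paths in this event that are close in L¹ have close times and heights
(`HasSkeleton.close`), so an L¹-ball of radius `ε` catches probability at most `(C n^d ε^(1+d))^n`.
For a suitable `ε`, `exp r` balls miss half of the event (`le_lintegral_min`,
`eventually_le_quantError`).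

For the converse, every `n ≤ √r` gets its own codebook: times are rounded to a grid and heights are
quantized with the help of the dimension hypothesis. Paths with more jumps are sent to zero
(`IsCompoundPoisson.exists_codebook`). A bound on `n log n + a r / n` uniform in `n`
(`eventually_le_mul_log_add`) then controls the sum over `n`, with a loss `η` that is finally sent
to `0`. -/

/-! ### Step paths and their L¹ geometry -/

section StepPath

variable {E : Type*}

/-- A step path is measurable, whatever the `σ`-field of the target. -/
theorem StepPath.measurable [MeasurableSpace E] (f : StepPath E) : Measurable f.1 := by
  obtain ⟨F, hF⟩ := f.2
  -- `p` records which times of `F` have passed. It takes values in a finite type and `f` factors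
  -- through it.
  let p : Set.Ico (0 : ℝ) 1 → (F → Prop) := fun t u => (u : ℝ) ≤ t
  have hp : Measurable p := by
    refine measurable_pi_lambda _ fun u => ?_
    exact measurableSet_setOfPred.1 (measurableSet_le measurable_const measurable_subtype_coe)
  have key : ∀ x y, p x = p y → x ≤ y → f.1 x = f.1 y := by
    intro x y h hxy
    refine hF x y hxy fun u hu hlt => ?_
    have := congrFun h ⟨u, hu⟩
    simp only [p, eq_iff_iff] at this
    exact absurd (this.2 hlt.2) (not_le.2 hlt.1)
  have hfac : f.1 = (Function.extend p f.1 fun _ => f.1 ⟨0, by simp⟩) ∘ p := by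
    funext x
    refine (Function.FactorsThrough.extend_apply (f := p) ?_ _ x).symm
    intro x y h
    rcases le_total x y with hxy | hxy
    · exact key x y h hxy
    · exact (key y x h.symm hxy).symm
  rw [hfac]
  exact (measurable_of_finite _).comp hp

theorem pathDist_comm [NormedAddCommGroup E] (f g : StepPath E) : pathDist f g = pathDist g f := by
  simp only [pathDist, normDist, enorm_sub_rev]

theorem pathDist_triangle [NormedAddCommGroup E] [SecondCountableTopology E]
    (f g h : StepPath E) : pathDist f h ≤ pathDist f g + pathDist g h := by
  borelize E
  have hm : Measurable fun t => normDist (f.1 t) (g.1 t) :=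
    (f.measurable.sub g.measurable).enorm
  rw [pathDist, pathDist, pathDist, ← lintegral_add_left hm]
  refine lintegral_mono fun t => ?_
  simp only [normDist]
  calc ‖f.1 t - h.1 t‖ₑ = ‖(f.1 t - g.1 t) + (g.1 t - h.1 t)‖ₑ := by abel_nf
    _ ≤ _ := enorm_add_le _ _

/-- The Lebesgue measure on `[0,1[`, on subintervals. -/
theorem comap_val_volume_le (a b : ℝ) :
    Measure.comap (Subtype.val : Set.Ico (0 : ℝ) 1 → ℝ) volume {t | a ≤ (t : ℝ) ∧ (t : ℝ) < b} ≤
      ENNReal.ofReal (b - a) := by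
  rw [(MeasurableEmbedding.subtype_coe measurableSet_Ico).comap_apply, ← Real.volume_Ico]
  refine measure_mono ?_
  rintro _ ⟨t, ht, rfl⟩
  exact ht

theorem comap_val_volume_eq {a b : ℝ} (ha : 0 ≤ a) (hb : b ≤ 1) :
    Measure.comap (Subtype.val : Set.Ico (0 : ℝ) 1 → ℝ) volume {t | a ≤ (t : ℝ) ∧ (t : ℝ) < b} =
      ENNReal.ofReal (b - a) := by
  rw [(MeasurableEmbedding.subtype_coe measurableSet_Ico).comap_apply, ← Real.volume_Ico]
  congr 1
  ext x
  constructor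
  · rintro ⟨t, ht, rfl⟩
    exact ht
  · intro hx
    exact ⟨⟨x, ha.trans hx.1, hx.2.trans_le hb⟩, hx, rfl⟩

theorem measurableSet_coe_mem_Ico (a b : ℝ) :
    MeasurableSet {t : Set.Ico (0 : ℝ) 1 | a ≤ (t : ℝ) ∧ (t : ℝ) < b} :=
  measurable_subtype_coe measurableSet_Ico

/-- If two paths at distance at most `D` differ by at least `c` on `[a,b[`, then
`c * (b - a) ≤ D`. -/
theorem mul_le_of_pathDist_le [NormedAddCommGroup E] {f g : StepPath E} {a b c D : ℝ}
    (ha : 0 ≤ a) (hb : b ≤ 1) (hc : 0 ≤ c) (hD : 0 ≤ D)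
    (h : ∀ t : Set.Ico (0 : ℝ) 1, a ≤ (t : ℝ) → (t : ℝ) < b → c ≤ ‖f.1 t - g.1 t‖)
    (hfg : pathDist f g ≤ ENNReal.ofReal D) : c * (b - a) ≤ D := by
  rw [← ENNReal.ofReal_le_ofReal_iff hD]
  refine le_trans ?_ hfg
  rw [ENNReal.ofReal_mul hc, ← comap_val_volume_eq ha hb, ← setLIntegral_const]
  refine (setLIntegral_mono' (measurableSet_coe_mem_Ico a b) fun t ht => ?_).trans
    (setLIntegral_le_lintegral _ _)
  rw [normDist, ← ofReal_norm]
  exact ENNReal.ofReal_le_ofReal (h t ht.1 ht.2)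

/-- `f` takes the value `S k` on `[σ k, σ (k+1)[` for `k ≤ n`, where the grid
`0 = σ 0 < ... < σ (n+1) = 1` has gaps at least `g` and the jumps of `f` have size at least `δ`. -/
structure HasSkeleton [NormedAddCommGroup E] (f : StepPath E) (n : ℕ) (g δ : ℝ) (σ : ℕ → ℝ)
    (S : ℕ → E) : Prop where
  start : σ 0 = 0
  gap : ∀ k ≤ n, σ k + g ≤ σ (k + 1)
  stop_eq : σ (n + 1) = 1
  value : ∀ k ≤ n, ∀ t : Set.Ico (0 : ℝ) 1, σ k ≤ (t : ℝ) → (t : ℝ) < σ (k + 1) → f.1 t = S k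
  jump : ∀ k < n, δ ≤ ‖S (k + 1) - S k‖

namespace HasSkeleton

variable [NormedAddCommGroup E] {f f' : StepPath E} {n : ℕ} {g δ D : ℝ} {σ σ' : ℕ → ℝ}
  {S S' : ℕ → E}

theorem mono (hf : HasSkeleton f n g δ σ S) (hg : 0 ≤ g) {j k : ℕ} (hjk : j ≤ k)
    (hk : k ≤ n + 1) : σ j ≤ σ k := by
  induction k, hjk using Nat.le_induction with
  | base => exact le_rfl
  | succ k hjk ih => linarith [ih (by omega), hf.gap k (by omega)]

theorem nonneg (hf : HasSkeleton f n g δ σ S) (hg : 0 ≤ g) {k : ℕ} (hk : k ≤ n + 1) : 0 ≤ σ k :=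
  hf.start ▸ hf.mono hg (Nat.zero_le k) hk

theorem le_one (hf : HasSkeleton f n g δ σ S) (hg : 0 ≤ g) {k : ℕ} (hk : k ≤ n + 1) : σ k ≤ 1 :=
  hf.stop_eq ▸ hf.mono hg hk le_rfl

/-- If `f'` makes its next jump later than `f`, then in between `f` has already left a value near
`S' k` by a jump of size at least `δ`, while `f'` still sits at `S' k`. The paths differ there by at
least `δ / 2`, so the delay is at most `2 * D / δ`. This is less than `g`, so `f` cannot have jumped
again in the meantime. -/
theorem time_sub_le (hf : HasSkeleton f n g δ σ S) (hf' : HasSkeleton f' n g δ σ' S')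
    (hg : 0 < g) (hδ : 0 < δ) (hD : 0 ≤ D) (hDg : 8 * D ≤ g * δ)
    (hff' : pathDist f f' ≤ ENNReal.ofReal D) {k : ℕ} (hk : k < n)
    (h1 : |σ k - σ' k| ≤ 2 * D / δ) (h2 : ‖S k - S' k‖ ≤ 2 * D / g) :
    σ' (k + 1) - σ (k + 1) ≤ 2 * D / δ := by
  have e1 : 2 * D / δ ≤ g / 4 := by rw [div_le_iff₀ hδ]; linarith
  have e2 : 2 * D / g ≤ δ / 4 := by rw [div_le_iff₀ hg]; linarith
  rcases le_total (σ' (k + 1)) (σ (k + 1)) with hle | hle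
  · have : 0 ≤ 2 * D / δ := by positivity
    linarith
  have hgap := hf.gap k (by omega)
  have hgap2 := hf.gap (k + 1) (by omega)
  rw [abs_le] at h1
  have key := mul_le_of_pathDist_le (f := f) (g := f') (a := σ (k + 1))
    (b := min (σ' (k + 1)) (σ (k + 1 + 1))) (c := δ / 2) (hf.nonneg hg.le (by omega))
    ((min_le_left _ _).trans (hf'.le_one hg.le (by omega)))
    (by positivity) hD ?_ hff'
  · have key' : min (σ' (k + 1)) (σ (k + 1 + 1)) - σ (k + 1) ≤ 2 * D / δ := by
      rw [le_div_iff₀ hδ]; linarith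
    rcases min_choice (σ' (k + 1)) (σ (k + 1 + 1)) with hm | hm
    · rwa [hm] at key'
    · rw [hm] at key'
      linarith
  · intro t ht1 ht2
    rw [lt_min_iff] at ht2
    rw [hf.value (k + 1) (by omega) t ht1 ht2.2,
      hf'.value k (by omega) t (by linarith) ht2.1]
    have := hf.jump k hk
    have h3 : ‖S (k + 1) - S k‖ ≤ ‖S (k + 1) - S' k‖ + ‖S k - S' k‖ := by
      calc ‖S (k + 1) - S k‖ = ‖(S (k + 1) - S' k) - (S k - S' k)‖ := by abel_nf
        _ ≤ _ := norm_sub_le _ _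
    linarith

/-- The `k`-th intervals of constancy overlap in length at least `g / 2`, and on the overlap the
paths differ by exactly `S k - S' k`. -/
theorem value_sub_le (hf : HasSkeleton f n g δ σ S) (hf' : HasSkeleton f' n g δ σ' S')
    (hg : 0 < g) (hδ : 0 < δ) (hD : 0 ≤ D) (hDg : 8 * D ≤ g * δ)
    (hff' : pathDist f f' ≤ ENNReal.ofReal D) {k : ℕ} (hk : k ≤ n)
    (h1 : |σ k - σ' k| ≤ 2 * D / δ) : ‖S k - S' k‖ ≤ 2 * D / g := by
  have e1 : 2 * D / δ ≤ g / 4 := by rw [div_le_iff₀ hδ]; linarith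
  rw [abs_le] at h1
  have hgap := hf.gap k hk
  have hgap' := hf'.gap k hk
  have hlen : g / 2 ≤ min (σ (k + 1)) (σ' (k + 1)) - max (σ k) (σ' k) := by
    rw [le_sub_iff_add_le]
    refine le_min ?_ ?_ <;> rcases max_choice (σ k) (σ' k) with hm | hm <;> rw [hm] <;> linarith
  have key := mul_le_of_pathDist_le (f := f) (g := f') (a := max (σ k) (σ' k))
    (b := min (σ (k + 1)) (σ' (k + 1))) (c := ‖S k - S' k‖)
    (le_max_of_le_left (hf.nonneg hg.le (by omega)))
    ((min_le_left _ _).trans (hf.le_one hg.le (by omega)))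
    (norm_nonneg _) hD ?_ hff'
  · rw [le_div_iff₀ hg]
    have := mul_le_mul_of_nonneg_left hlen (norm_nonneg (S k - S' k))
    linarith
  · intro t ht1 ht2
    rw [max_le_iff] at ht1
    rw [lt_min_iff] at ht2
    rw [hf.value k hk t ht1.1 ht2.1, hf'.value k hk t ht1.2 ht2.2]

/-- Two step paths that are close in `L¹` have close jump times and close values. -/
theorem close (hf : HasSkeleton f n g δ σ S) (hf' : HasSkeleton f' n g δ σ' S')
    (hg : 0 < g) (hδ : 0 < δ) (hD : 0 ≤ D) (hDg : 8 * D ≤ g * δ)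
    (hff' : pathDist f f' ≤ ENNReal.ofReal D) {k : ℕ} (hk : k ≤ n) :
    |σ k - σ' k| ≤ 2 * D / δ ∧ ‖S k - S' k‖ ≤ 2 * D / g := by
  suffices h : |σ k - σ' k| ≤ 2 * D / δ from
    ⟨h, hf.value_sub_le hf' hg hδ hD hDg hff' hk h⟩
  -- Times and values are controlled alternately: a close `k`-th time gives a close `k`-th value,
  -- and both give a close next time. Exchanging the two paths bounds the time difference from the
  -- other side.
  induction k with
  | zero =>
    rw [hf.start, hf'.start, sub_self, abs_zero]
    positivity
  | succ k ih =>
    have h1 := ih (by omega)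
    have h2 := hf.value_sub_le hf' hg hδ hD hDg hff' (by omega) h1
    rw [abs_sub_le_iff]
    refine ⟨?_, hf.time_sub_le hf' hg hδ hD hDg hff' (by omega) h1 h2⟩
    refine hf'.time_sub_le hf hg hδ hD hDg (by rwa [pathDist_comm]) (by omega) ?_ ?_
    · rwa [abs_sub_comm]
    · rwa [norm_sub_rev]

end HasSkeleton

/-- The path that jumps by `z i` at time `τ i`, for `i < n`. -/
noncomputable def jumpPath [AddCommMonoid E] (n : ℕ) (τ : ℕ → ℝ) (z : ℕ → E) : StepPath E :=
  ⟨fun t => ∑ i ∈ Finset.range n, if τ i ≤ (t : ℝ) then z i else 0, by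
    refine ⟨(Finset.range n).image τ, fun x y hxy h => Finset.sum_congr rfl fun i hi => ?_⟩
    have := h (τ i) (Finset.mem_image_of_mem τ hi)
    have hiff : τ i ≤ (x : ℝ) ↔ τ i ≤ (y : ℝ) :=
      ⟨fun h => h.trans hxy, fun h => by by_contra hlt; exact this ⟨not_le.1 hlt, h⟩⟩
    simp only [hiff]⟩

/-- Jumps that are close and that come slightly too early give a path that is close. -/
theorem pathDist_jumpPath_le [NormedAddCommGroup E] {n : ℕ} {τ τ' : ℕ → ℝ} {h : ℝ} (z z' : ℕ → E)
    (h1 : ∀ i < n, τ' i ≤ τ i) (h2 : ∀ i < n, τ i ≤ τ' i + h) :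
    pathDist (jumpPath n τ z) (jumpPath n τ' z') ≤
      ∑ i ∈ Finset.range n, (‖z i - z' i‖ₑ + ‖z i‖ₑ * ENNReal.ofReal h) := by
  -- On `A i` only the second path has made its `i`-th jump. The resulting error `‖z' i‖` is split
  -- so that only `‖z i‖` gets multiplied by the delay.
  let A : ℕ → Set (Set.Ico (0 : ℝ) 1) := fun i => {t | τ' i ≤ (t : ℝ) ∧ (t : ℝ) < τ i}
  have hA : ∀ i, MeasurableSet (A i) := fun i => measurableSet_coe_mem_Ico _ _
  calc pathDist (jumpPath n τ z) (jumpPath n τ' z')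
      ≤ ∫⁻ t : Set.Ico (0 : ℝ) 1, ∑ i ∈ Finset.range n,
          (‖z i - z' i‖ₑ + (A i).indicator (fun _ => ‖z i‖ₑ) t)
          ∂(Measure.comap Subtype.val volume) := by
        refine lintegral_mono fun t => ?_
        simp only [normDist, jumpPath, ← Finset.sum_sub_distrib]
        refine (enorm_sum_le _ _).trans (Finset.sum_le_sum fun i hi => ?_)
        have hi1 := h1 i (Finset.mem_range.1 hi)
        by_cases ha : τ i ≤ (t : ℝ)
        · rw [if_pos ha, if_pos (hi1.trans ha)]
          exact le_self_add
        · by_cases hb : τ' i ≤ (t : ℝ)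
          · rw [if_neg ha, if_pos hb, Set.indicator_of_mem (show t ∈ A i from ⟨hb, not_le.1 ha⟩)]
            calc ‖(0 : E) - z' i‖ₑ = ‖(z i - z' i) + -z i‖ₑ := by abel_nf
              _ ≤ _ := (enorm_add_le _ _).trans_eq (by rw [enorm_neg])
          · rw [if_neg ha, if_neg hb]
            simp
    _ = ∑ i ∈ Finset.range n, (‖z i - z' i‖ₑ + ‖z i‖ₑ *
          Measure.comap (Subtype.val : Set.Ico (0 : ℝ) 1 → ℝ) volume (A i)) := by
        have hm : ∀ i ∈ Finset.range n, Measurable fun t =>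
            ‖z i - z' i‖ₑ + (A i).indicator (fun _ => ‖z i‖ₑ) t :=
          fun i _ => (measurable_const.indicator (hA i)).const_add _
        rw [lintegral_finsetSum _ hm]
        refine Finset.sum_congr rfl fun i _ => ?_
        rw [lintegral_add_left measurable_const, lintegral_const, lintegral_indicator_const (hA i)]
        have huniv : {t : Set.Ico (0 : ℝ) 1 | 0 ≤ (t : ℝ) ∧ (t : ℝ) < 1} = Set.univ :=
          Set.eq_univ_of_forall fun t => t.2
        rw [← huniv, comap_val_volume_eq le_rfl le_rfl, sub_zero, ENNReal.ofReal_one, mul_one]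
    _ ≤ _ := by
        refine Finset.sum_le_sum fun i hi => ?_
        gcongr
        refine (comap_val_volume_le _ _).trans (ENNReal.ofReal_le_ofReal ?_)
        linarith [h2 i (Finset.mem_range.1 hi)]

end StepPath

/-! ### The counting process as a finite sum of jumps -/

section CountingProcess

variable {Ω : Type*} {lam : ℝ} {e : ℕ → Ω → ℝ} {ω : Ω}

theorem sum_range_mono (he : ∀ i, 0 ≤ e i ω) : Monotone fun n => ∑ i ∈ Finset.range n, e i ω :=
  fun _ _ h => Finset.sum_le_sum_of_subset_of_nonneg (Finset.range_mono h) fun i _ _ => he i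

theorem countingProcess_eq (he : ∀ i, 0 ≤ e i ω) {t : ℝ} {n : ℕ}
    (h1 : ∑ i ∈ Finset.range n, e i ω ≤ lam * t)
    (h2 : lam * t < ∑ i ∈ Finset.range (n + 1), e i ω) : countingProcess lam e t ω = n := by
  have hset : {k : ℕ | ∑ i ∈ Finset.range k, e i ω ≤ lam * t} = Set.Iic n := by
    ext k
    simp only [Set.mem_ofPred_eq, Set.mem_Iic]
    refine ⟨fun hk => ?_, fun hk => (sum_range_mono he hk).trans h1⟩
    by_contra hlt
    exact absurd (sum_range_mono he (show n + 1 ≤ k by omega)) (not_le.2 (hk.trans_lt h2))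
  rw [countingProcess, hset, csSup_Iic]

/-- The compound sum, when the counting process stops at `n`, is that of a path with `n` jumps. -/
theorem sum_range_countingProcess {E : Type*} [AddCommMonoid E] (hlam : 0 < lam)
    (he : ∀ i, 0 ≤ e i ω) {n : ℕ} (hn : lam ≤ ∑ i ∈ Finset.range (n + 1), e i ω) (z : ℕ → E)
    {t : ℝ} (ht0 : 0 ≤ t) (ht : t < 1) :
    ∑ i ∈ Finset.range (countingProcess lam e t ω), z i =
      ∑ i ∈ Finset.range n,
        if (∑ j ∈ Finset.range (i + 1), e j ω) / lam ≤ t then z i else 0 := by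
  have hmono := sum_range_mono he
  have hbound : ∃ k, lam * t < ∑ i ∈ Finset.range (k + 1), e i ω := ⟨n, by nlinarith⟩
  classical
  obtain ⟨hN2, hNmin⟩ : lam * t < ∑ i ∈ Finset.range (Nat.find hbound + 1), e i ω ∧
      ∀ k < Nat.find hbound, ∑ i ∈ Finset.range (k + 1), e i ω ≤ lam * t :=
    ⟨Nat.find_spec hbound, fun k hk => not_lt.1 (Nat.find_min hbound hk)⟩
  have hNn : Nat.find hbound ≤ n := Nat.find_min' hbound (by nlinarith)
  generalize Nat.find hbound = N at *
  have hN1 : ∑ i ∈ Finset.range N, e i ω ≤ lam * t := by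
    rcases N with _ | N
    · simpa using by positivity
    · exact hNmin N (by omega)
  rw [countingProcess_eq he hN1 hN2, ← Finset.sum_filter]
  congr 1
  ext i
  simp only [Finset.mem_filter, Finset.mem_range, div_le_iff₀ hlam, mul_comm t]
  constructor
  · exact fun hi => ⟨by omega, hNmin i hi⟩
  · rintro ⟨-, hi⟩
    by_contra hlt
    exact absurd (hmono (show N + 1 ≤ i + 1 by omega)) (not_le.2 (hi.trans_lt hN2))

end CountingProcess

/-! ### Small-ball estimate for the compound Poisson path -/

section LowerBound

/-- Off the carrier `Sᶜ` of the singular part, `μ` has density `f`. The sets where `f ≤ k` and `‖z‖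
≥ 1 / (k + 1)` exhaust `S` up to the origin and the points with `f = ∞`. All exceptional sets are
`ν`-null, so one of these sets has positive `ν`-measure, hence positive `μ`-measure. -/
theorem exists_bounded_density_set {d : ℕ} (μ : Measure (Fin d → ℝ)) [IsFiniteMeasure μ]
    (hac : HasACComponent μ) (h0 : μ {0} = 0) :
    ∃ G : Set (Fin d → ℝ), MeasurableSet G ∧ μ G ≠ 0 ∧ (∃ δ : ℝ, 0 < δ ∧ ∀ z ∈ G, δ ≤ ‖z‖) ∧
      ∃ M : ℕ, ∀ A, MeasurableSet A → μ (A ∩ G) ≤ M * volume A := by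
  obtain ⟨ν, hν0, hνμ, hνv⟩ := hac
  obtain ⟨S, hS, hS1, hS2⟩ := Measure.mutuallySingular_singularPart μ volume
  set f := μ.rnDeriv volume with hf
  have hfm : Measurable f := Measure.measurable_rnDeriv _ _
  let G : ℕ → Set (Fin d → ℝ) := fun k => S ∩ ({z | f z ≤ k} ∩ {z | ((k : ℝ) + 1)⁻¹ ≤ ‖z‖})
  have hG : ∀ k, MeasurableSet (G k) := fun k =>
    hS.inter ((measurableSet_le hfm measurable_const).inter
      (measurableSet_le measurable_const measurable_norm))
  have hsub : (Set.univ : Set (Fin d → ℝ)) ⊆ Sᶜ ∪ ({z | f z = ∞} ∪ ({0} ∪ ⋃ k, G k)) := by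
    intro z _
    by_cases h1 : z ∈ S
    swap
    · exact Or.inl h1
    by_cases h2 : f z = ∞
    · exact Or.inr (Or.inl h2)
    by_cases h3 : z = 0
    · exact Or.inr (Or.inr (Or.inl h3))
    refine Or.inr (Or.inr (Or.inr (Set.mem_iUnion.2 ?_)))
    obtain ⟨k1, hk1⟩ := ENNReal.exists_nat_gt h2
    obtain ⟨k2, hk2⟩ := exists_nat_gt (‖z‖⁻¹)
    refine ⟨max k1 k2, h1, ?_, ?_⟩
    · exact hk1.le.trans (by exact_mod_cast le_max_left _ _)
    · have : ‖z‖⁻¹ ≤ ((max k1 k2 : ℕ) : ℝ) + 1 := by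
        have : (k2 : ℝ) ≤ ((max k1 k2 : ℕ) : ℝ) := by exact_mod_cast le_max_right _ _
        linarith
      exact inv_le_of_inv_le₀ (norm_pos_iff.2 h3) this
  have hex : ∃ k, ν (G k) ≠ 0 := by
    by_contra! hall
    refine hν0 (Measure.measure_univ_eq_zero.1 (measure_mono_null hsub ?_))
    refine measure_union_null (hνv hS2) (measure_union_null (hνv ?_) (measure_union_null ?_ ?_))
    · have := Measure.rnDeriv_lt_top μ volume
      rw [ae_iff] at this
      simpa using this
    · exact le_antisymm ((hνμ _).trans h0.le) zero_le
    · exact measure_iUnion_null hall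
  obtain ⟨k, hk⟩ := hex
  refine ⟨G k, hG k, fun h => hk (le_antisymm ((hνμ _).trans h.le) zero_le),
    ⟨((k : ℝ) + 1)⁻¹, by positivity, fun z hz => hz.2.2⟩, k, fun A hA => ?_⟩
  rw [Measure.haveLebesgueDecomposition_add μ volume, Measure.add_apply,
    measure_mono_null (fun z hz => hz.2.1) hS1, zero_add, withDensity_apply _ (hA.inter (hG k))]
  calc ∫⁻ z in A ∩ G k, f z ≤ ∫⁻ _ in A ∩ G k, k :=
        setLIntegral_mono' (hA.inter (hG k)) fun z hz => hz.2.2.1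
    _ = k * volume (A ∩ G k) := setLIntegral_const _ _
    _ ≤ k * volume A := by gcongr; exact Set.inter_subset_left

theorem expMeasure_one_apply_le (A : Set ℝ) (hA : MeasurableSet A) :
    expMeasure 1 A ≤ volume A := by
  change (volume.withDensity (exponentialPDF 1)) A ≤ _
  rw [withDensity_apply _ hA]
  calc ∫⁻ x in A, exponentialPDF 1 x ≤ ∫⁻ _ in A, 1 := by
        refine lintegral_mono fun x => ?_
        rw [exponentialPDF_eq]
        split_ifs with h
        · simpa using h
        · simp
    _ = _ := by simp

theorem le_expMeasure_one_Icc {a b : ℝ} (ha : 0 ≤ a) :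
    ENNReal.ofReal (Real.exp (-b) * (b - a)) ≤ expMeasure 1 (Set.Icc a b) := by
  change _ ≤ (volume.withDensity (exponentialPDF 1)) (Set.Icc a b)
  rw [withDensity_apply _ measurableSet_Icc, ENNReal.ofReal_mul (Real.exp_pos _).le,
    ← Real.volume_Icc, ← setLIntegral_const]
  refine setLIntegral_mono' measurableSet_Icc fun x hx => ?_
  rw [exponentialPDF_of_nonneg (ha.trans hx.1)]
  refine ENNReal.ofReal_le_ofReal ?_
  rw [one_mul, one_mul]
  exact Real.exp_le_exp.2 (by linarith [hx.2])

theorem expMeasure_one_Iio_zero : expMeasure 1 (Set.Iio 0) = 0 := by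
  change (volume.withDensity (exponentialPDF 1)) (Set.Iio 0) = 0
  rw [withDensity_apply _ measurableSet_Iio]
  exact lintegral_exponentialPDF_of_nonpos le_rfl

/-- On the event that there are exactly `n` jumps, well separated, in the first half of the
interval, the compound Poisson path has a skeleton. -/
theorem hasSkeleton_of_mem {Ω E : Type*} [NormedAddCommGroup E] {lam : ℝ} {e : ℕ → Ω → ℝ}
    {Z : ℕ → Ω → E} {f : StepPath E} {n : ℕ} (hn : 1 ≤ n) {δ : ℝ} (hlam : 0 < lam) {ω : Ω}
    (he : ∀ i, 0 ≤ e i ω)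
    (hf : ∀ t : Set.Ico (0 : ℝ) 1,
      f.1 t = ∑ i ∈ Finset.range (countingProcess lam e (t : ℝ) ω), Z i ω)
    (h1 : ∀ i < n, e i ω ∈ Set.Icc (lam / (4 * n)) (lam / (2 * n))) (h2 : lam ≤ e n ω)
    (hZ : ∀ i < n, δ ≤ ‖Z i ω‖) :
    HasSkeleton f n (1 / (4 * n)) δ
      (fun k => if k ≤ n then (∑ j ∈ Finset.range k, e j ω) / lam else 1)
      (fun k => ∑ i ∈ Finset.range k, Z i ω) where
  start := by simp
  gap k hk := by
    have hn' : (1 : ℝ) ≤ n := by exact_mod_cast hn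
    rcases hk.lt_or_eq with hlt | rfl
    · rw [if_pos hk, if_pos (by omega), Finset.sum_range_succ, add_div]
      have := (h1 k hlt).1
      have h3 : 1 / (4 * (n : ℝ)) ≤ e k ω / lam := by
        rw [le_div_iff₀ hlam]
        exact (by ring : 1 / (4 * (n : ℝ)) * lam = lam / (4 * n)).trans_le this
      linarith
    -- The `n` waiting times sum to at most `lam / 2`, so the last interval of constancy has length
    -- at least `1 / 2`.
    · rw [if_pos le_rfl, if_neg (by omega)]
      have hsum : ∑ j ∈ Finset.range k, e j ω ≤ k * (lam / (2 * k)) := by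
        rw [← nsmul_eq_mul]
        simpa using Finset.sum_le_card_nsmul (Finset.range k) (fun j => e j ω) _
          fun j hj => (h1 j (Finset.mem_range.1 hj)).2
      have h3 : (k : ℝ) * (lam / (2 * k)) = 1 / 2 * lam := by field_simp
      have h4 : (∑ j ∈ Finset.range k, e j ω) / lam ≤ 1 / 2 := by
        rw [div_le_iff₀ hlam]; linarith
      have h5 : 1 / (4 * (k : ℝ)) ≤ 1 / 4 := by
        apply one_div_le_one_div_of_le <;> linarith
      linarith
  stop_eq := by simp
  value k hk t ht1 ht2 := by
    rw [hf, countingProcess_eq he (n := k)]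
    · rw [if_pos hk, div_le_iff₀ hlam] at ht1
      linarith
    · rcases hk.lt_or_eq with hlt | rfl
      · rw [if_pos (by omega), lt_div_iff₀ hlam] at ht2
        linarith
      · rw [Finset.sum_range_succ]
        have := Finset.sum_nonneg fun j (_ : j ∈ Finset.range k) => he j
        nlinarith [t.2.2]
  jump k hk := by
    rw [Finset.sum_range_succ, add_sub_cancel_left]
    exact hZ k hk

variable {Ω E : Type*} [MeasurableSpace Ω] [NormedAddCommGroup E] [MeasurableSpace E]
  {P : Measure Ω} {lam : ℝ} {e : ℕ → Ω → ℝ} {Z : ℕ → Ω → E} {X : Ω → StepPath E}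

namespace IsCompoundPoisson

theorem measure_rect (hX : IsCompoundPoisson P lam e Z X) (m n : ℕ) {A : ℕ → Set ℝ}
    {B : ℕ → Set E} (hA : ∀ i, MeasurableSet (A i)) (hB : ∀ i, MeasurableSet (B i)) :
    P {ω | (∀ i < m, e i ω ∈ A i) ∧ ∀ i < n, Z i ω ∈ B i} =
      (∏ i ∈ Finset.range m, expMeasure 1 (A i)) * ∏ i ∈ Finset.range n, P.map (Z 0) (B i) := by
  have h1 : {ω | (∀ i < m, e i ω ∈ A i) ∧ ∀ i < n, Z i ω ∈ B i} =
      (fun ω i => e i ω) ⁻¹' (⋂ i ∈ Finset.range m, (fun x : ℕ → ℝ => x i) ⁻¹' A i) ∩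
      (fun ω i => Z i ω) ⁻¹' (⋂ i ∈ Finset.range n, (fun x : ℕ → E => x i) ⁻¹' B i) := by
    ext ω
    simp
  rw [h1, hX.indep_e_Z.measure_inter_preimage_eq_mul _ _
    (Finset.measurableSet_biInter _ fun i _ => measurable_pi_apply i (hA i))
    (Finset.measurableSet_biInter _ fun i _ => measurable_pi_apply i (hB i))]
  simp only [Set.preimage_iInter, ← Set.preimage_comp]
  congr 1
  · refine (hX.iIndep_e.measure_inter_preimage_eq_mul (Finset.range m)
      (fun i _ => hA i)).trans (Finset.prod_congr rfl fun i _ => ?_)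
    rw [← hX.law_e i, Measure.map_apply (hX.measurable_e i) (hA i)]
  · refine (hX.iIndep_Z.measure_inter_preimage_eq_mul (Finset.range n)
      (fun i _ => hB i)).trans (Finset.prod_congr rfl fun i _ => ?_)
    rw [← (hX.identDistrib_Z i).map_eq, Measure.map_apply (hX.measurable_Z i) (hB i)]

theorem ae_nonneg (hX : IsCompoundPoisson P lam e Z X) : ∀ᵐ ω ∂P, ∀ i, 0 ≤ e i ω := by
  rw [ae_all_iff]
  intro i
  rw [ae_iff]
  have := expMeasure_one_Iio_zero
  rw [← hX.law_e i, Measure.map_apply (hX.measurable_e i) measurableSet_Iio] at this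
  simpa [Set.preimage] using this

end IsCompoundPoisson

/-- The term `(c / n) ^ n` bounds from below the probability of `n` well-separated jumps. Each
codeword accounts for at most `(C * n ^ d * ε ^ (1 + d)) ^ n` of it, as the paths of this event near
a codeword have all their waiting times and heights in a box. Outside these boxes the error is at
least `ε`. -/
theorem le_lintegral_min {d : ℕ} [IsProbabilityMeasure P] {s : ℝ}
    {Z : ℕ → Ω → Fin d → ℝ} {X : Ω → StepPath (Fin d → ℝ)} (hlam : 0 < lam) (hs : 0 < s)
    (hX : IsCompoundPoisson P lam e Z X) (hac : HasACComponent (P.map (Z 0))) :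
    ∃ c > 0, ∃ C > 0, ∀ n : ℕ, 1 ≤ n → ∀ ε : ℝ, 0 < ε → ε ≤ c / n →
      ∀ B : Finset (StepPath (Fin d → ℝ)),
        ENNReal.ofReal (ε ^ s * ((c / n) ^ n - B.card * (C * n ^ d * ε ^ (1 + d)) ^ n)) ≤
          ∫⁻ ω, ⨅ a ∈ B, pathDist (X ω) a ^ s ∂P := by
  have : IsProbabilityMeasure (P.map (Z 0)) :=
    Measure.isProbabilityMeasure_map (hX.measurable_Z 0).aemeasurable
  obtain ⟨G, hG, hG0, ⟨δ, hδ, hGδ⟩, M, hM⟩ := exists_bounded_density_set (P.map (Z 0)) hac (by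
    rw [Measure.map_apply (hX.measurable_Z 0) (measurableSet_singleton 0)]
    exact hX.Z_ne_zero)
  set p := (P.map (Z 0)).real G with hp
  have hp0 : 0 < p := ENNReal.toReal_pos hG0 (measure_ne_top _ _)
  have hp1 : P.map (Z 0) G = ENNReal.ofReal p := by rw [hp, ofReal_measureReal]
  -- The first entry is the probability cost per jump. Its factor `exp (-(lam + 1))` is needed only
  -- once, for the waiting time after the last jump, but may be raised to the power `n`. The second
  -- entry makes `ε ≤ c / n` small enough for `HasSkeleton.close`, with gaps `1 / (4 * n)` and
  -- distance `2 * ε`.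
  set c := min (lam / 4 * Real.exp (-lam) * Real.exp (-(lam + 1)) * p) (δ / 64) with hc
  have hc0 : 0 < c := lt_min (by positivity) (by positivity)
  -- The box has sides `16 * lam * ε / δ` for a waiting time and `64 * n * ε` for each coordinate of
  -- a height. `M + 1` replaces `M` to keep the constant positive.
  refine ⟨c, hc0, 16 * lam / δ * ((M + 1) * 64 ^ d), by positivity, fun n hn ε hε hεc B => ?_⟩
  set C := 16 * lam / δ * ((M + 1) * 64 ^ d) with hC
  have hn0 : (0 : ℝ) < n := by exact_mod_cast hn
  have hn1 : (1 : ℝ) ≤ n := by exact_mod_cast hn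
  -- the event
  let A : ℕ → Set ℝ := fun i =>
    if i < n then Set.Icc (lam / (4 * n)) (lam / (2 * n)) else Set.Icc lam (lam + 1)
  have hA : ∀ i, MeasurableSet (A i) := fun i => by
    simp only [A]; split_ifs <;> exact measurableSet_Icc
  let H : Set Ω := {ω | (∀ i < n + 1, e i ω ∈ A i) ∧ ∀ i < n, Z i ω ∈ G}
  have hHP : ENNReal.ofReal ((c / n) ^ n) ≤ P H := by
    simp only [H]
    rw [hX.measure_rect (n + 1) n hA fun _ => hG, Finset.prod_range_succ, Finset.prod_const,
      Finset.card_range, hp1]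
    have e1 : ENNReal.ofReal (Real.exp (-lam) * (lam / (4 * n))) ^ n ≤
        ∏ i ∈ Finset.range n, expMeasure 1 (A i) := by
      refine le_trans (by rw [Finset.card_range])
        (Finset.pow_card_le_prod (Finset.range n) _ _ fun i hi => ?_)
      simp only [A, if_pos (Finset.mem_range.1 hi)]
      refine le_trans (ENNReal.ofReal_le_ofReal ?_) (le_expMeasure_one_Icc (by positivity))
      have h1 : lam / (2 * n) - lam / (4 * n) = lam / (4 * n) := by field_simp; norm_num
      rw [h1]
      gcongr
      exact div_le_self hlam.le (by linarith)
    have e2 : ENNReal.ofReal (Real.exp (-(lam + 1))) ≤ expMeasure 1 (A n) := by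
      simp only [A, lt_irrefl, if_false]
      have := le_expMeasure_one_Icc (a := lam) (b := lam + 1) hlam.le
      rwa [add_sub_cancel_left, mul_one] at this
    refine le_trans ?_ (mul_le_mul' (mul_le_mul' e1 e2) le_rfl)
    rw [← ENNReal.ofReal_pow (by positivity), ← ENNReal.ofReal_pow (by positivity),
      ← ENNReal.ofReal_mul (by positivity), ← ENNReal.ofReal_mul (by positivity)]
    refine ENNReal.ofReal_le_ofReal ?_
    calc (c / n) ^ n ≤
          (lam / 4 * Real.exp (-lam) * Real.exp (-(lam + 1)) * p / n) ^ n := by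
          gcongr
          exact min_le_left _ _
      _ = (Real.exp (-lam) * (lam / (4 * n))) ^ n * Real.exp (-(lam + 1)) ^ n * p ^ n := by
          rw [← mul_pow, ← mul_pow]
          congr 1
          field_simp
      _ ≤ _ := by
          gcongr
          exact pow_le_of_le_one (Real.exp_pos _).le (Real.exp_le_one_iff.2 (by linarith))
            (by omega)
  have hHm : MeasurableSet H := by
    have h1 : H = (⋂ i ∈ Finset.range (n + 1), e i ⁻¹' A i) ∩
        ⋂ i ∈ Finset.range n, Z i ⁻¹' G := by
      ext ω
      simp [H]
    rw [h1]
    exact (Finset.measurableSet_biInter _ fun i _ => hX.measurable_e i (hA i)).inter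
      (Finset.measurableSet_biInter _ fun i _ => hX.measurable_Z i hG)
  let good : Set Ω := {ω | (∀ i, 0 ≤ e i ω) ∧ ∀ t : Set.Ico (0 : ℝ) 1,
    (X ω).1 t = ∑ i ∈ Finset.range (countingProcess lam e (t : ℝ) ω), Z i ω}
  have hgood : ∀ᵐ ω ∂P, ω ∈ good := by
    filter_upwards [hX.ae_nonneg, hX.X_eq] with ω h1 h2 using ⟨h1, h2⟩
  have hskel : ∀ ω ∈ H, ω ∈ good → HasSkeleton (X ω) n (1 / (4 * n)) δ
      (fun k => if k ≤ n then (∑ j ∈ Finset.range k, e j ω) / lam else 1)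
      (fun k => ∑ i ∈ Finset.range k, Z i ω) := by
    intro ω hω hg
    refine hasSkeleton_of_mem hn hlam hg.1 hg.2 (fun i hi => ?_) ?_ fun i hi => hGδ _ (hω.2 i hi)
    · simpa only [A, if_pos hi] using hω.1 i (by omega)
    · have := hω.1 n (by omega)
      simp only [A, lt_irrefl, if_false] at this
      exact this.1
  have hclose : ∀ a, ∀ ω ∈ H, ω ∈ good → ∀ ω' ∈ H, ω' ∈ good →
      pathDist (X ω) a ≤ ENNReal.ofReal ε → pathDist (X ω') a ≤ ENNReal.ofReal ε →
      ∀ i < n, |e i ω - e i ω'| ≤ 8 * lam * ε / δ ∧ ‖Z i ω - Z i ω'‖ ≤ 32 * n * ε := by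
    intro a ω hω hg ω' hω' hg' hd hd' i hi
    have hdist : pathDist (X ω) (X ω') ≤ ENNReal.ofReal (2 * ε) := by
      refine (pathDist_triangle _ a _).trans ?_
      rw [two_mul, ENNReal.ofReal_add hε.le hε.le, pathDist_comm a]
      exact add_le_add hd hd'
    have hsmall : 8 * (2 * ε) ≤ 1 / (4 * n) * δ := by
      have h1 : ε ≤ δ / 64 / n := hεc.trans (by gcongr; exact min_le_right _ _)
      have h2 : 1 / (4 * (n : ℝ)) * δ = 16 * (δ / 64 / n) := by field_simp; norm_num
      rw [h2]
      linarith
    have key := fun k (hk : k ≤ n) => (hskel ω hω hg).close (hskel ω' hω' hg') (by positivity) hδ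
      (by positivity) hsmall hdist hk
    have k1 := key i hi.le
    have k2 := key (i + 1) hi
    simp only [if_pos hi.le, if_pos (show i + 1 ≤ n from hi), Finset.sum_range_succ] at k1 k2
    constructor
    · have h1 : e i ω - e i ω' = lam * (((∑ j ∈ Finset.range i, e j ω + e i ω) / lam -
          (∑ j ∈ Finset.range i, e j ω' + e i ω') / lam) -
          ((∑ j ∈ Finset.range i, e j ω) / lam - (∑ j ∈ Finset.range i, e j ω') / lam)) := by
        field_simp
        ring
      rw [h1, abs_mul, abs_of_pos hlam]
      calc _ ≤ lam * (2 * (2 * ε) / δ + 2 * (2 * ε) / δ) := by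
            gcongr
            exact (abs_sub _ _).trans (add_le_add k2.1 k1.1)
        _ = _ := by ring
    · have h1 : Z i ω - Z i ω' = ((∑ j ∈ Finset.range i, Z j ω + Z i ω) -
          (∑ j ∈ Finset.range i, Z j ω' + Z i ω')) -
          (∑ j ∈ Finset.range i, Z j ω - ∑ j ∈ Finset.range i, Z j ω') := by abel
      rw [h1]
      calc _ ≤ 2 * (2 * ε) / (1 / (4 * n)) + 2 * (2 * ε) / (1 / (4 * n)) :=
            (norm_sub_le _ _).trans (add_le_add k2.2 k1.2)
        _ = _ := by field_simp; norm_num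
  -- covering boxes
  have hbox : ∀ a, ∃ W : Set Ω, MeasurableSet W ∧
      P W ≤ ENNReal.ofReal ((C * n ^ d * ε ^ (1 + d)) ^ n) ∧
      ∀ ω ∈ H, ω ∈ good → pathDist (X ω) a ≤ ENNReal.ofReal ε → ω ∈ W := by
    intro a
    -- The codeword `a` is arbitrary and need not have `n` jumps. The box is therefore centred at a
    -- sample of the event whose path is close to `a`.
    by_cases hex : ∃ ω' ∈ H, ω' ∈ good ∧ pathDist (X ω') a ≤ ENNReal.ofReal ε
    swap
    · exact ⟨∅, MeasurableSet.empty, by simp,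
        fun ω h1 h2 h3 => absurd ⟨ω, h1, h2, h3⟩ hex⟩
    obtain ⟨ω', h1', h2', h3'⟩ := hex
    let U : ℕ → Set ℝ := fun i => Metric.closedBall (e i ω') (8 * lam * ε / δ)
    let V : ℕ → Set (Fin d → ℝ) := fun i => Metric.closedBall (Z i ω') (32 * n * ε) ∩ G
    have hU : ∀ i, MeasurableSet (U i) := fun i => measurableSet_closedBall
    have hV : ∀ i, MeasurableSet (V i) := fun i => measurableSet_closedBall.inter hG
    refine ⟨{ω | (∀ i < n, e i ω ∈ U i) ∧ ∀ i < n, Z i ω ∈ V i}, ?_, ?_, ?_⟩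
    · have h1 : {ω | (∀ i < n, e i ω ∈ U i) ∧ ∀ i < n, Z i ω ∈ V i} =
          (⋂ i ∈ Finset.range n, e i ⁻¹' U i) ∩ ⋂ i ∈ Finset.range n, Z i ⁻¹' V i := by
        ext ω
        simp
      rw [h1]
      exact (Finset.measurableSet_biInter _ fun i _ => hX.measurable_e i (hU i)).inter
        (Finset.measurableSet_biInter _ fun i _ => hX.measurable_Z i (hV i))
    · rw [hX.measure_rect n n hU hV, ← Finset.prod_mul_distrib, ENNReal.ofReal_pow (by positivity)]
      refine (Finset.prod_le_pow_card _ _ _ fun i _ => ?_).trans_eq (by rw [Finset.card_range])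
      calc expMeasure 1 (U i) * P.map (Z 0) (V i)
          ≤ ENNReal.ofReal (2 * (8 * lam * ε / δ)) *
              (M * ENNReal.ofReal ((2 * (32 * n * ε)) ^ d)) := by
            refine mul_le_mul' ?_ ?_
            · exact (expMeasure_one_apply_le _ (hU i)).trans_eq (Real.volume_closedBall _ _)
            · refine (hM _ measurableSet_closedBall).trans_eq ?_
              rw [Real.volume_pi_closedBall _ (by positivity), Fintype.card_fin]
        _ ≤ ENNReal.ofReal (2 * (8 * lam * ε / δ)) *
              (ENNReal.ofReal (M + 1) * ENNReal.ofReal ((2 * (32 * n * ε)) ^ d)) := by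
            gcongr
            rw [← ENNReal.ofReal_natCast]
            exact ENNReal.ofReal_le_ofReal (by linarith)
        _ = ENNReal.ofReal (C * n ^ d * ε ^ (1 + d)) := by
            rw [← ENNReal.ofReal_mul (by positivity), ← ENNReal.ofReal_mul (by positivity)]
            congr 1
            rw [hC, pow_add, mul_pow, mul_pow, mul_pow, show (64 : ℝ) = 2 * 32 by norm_num,
              mul_pow]
            ring
    · intro ω h1 h2 h3
      have := hclose a ω h1 h2 ω' h1' h2' h3 h3'
      refine ⟨fun i hi => ?_, fun i hi => ⟨?_, h1.2 i hi⟩⟩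
      · rw [Metric.mem_closedBall, Real.dist_eq]
        exact (this i hi).1
      · rw [Metric.mem_closedBall, dist_eq_norm]
        exact (this i hi).2
  choose W hWm hWP hW using hbox
  let K : Set Ω := H \ ⋃ a ∈ B, W a
  have hKm : MeasurableSet K := hHm.diff (Finset.measurableSet_biUnion _ fun a _ => hWm a)
  have hKP : ENNReal.ofReal ((c / n) ^ n - B.card * (C * n ^ d * ε ^ (1 + d)) ^ n) ≤ P K := by
    rw [ENNReal.ofReal_sub _ (by positivity)]
    refine (tsub_le_tsub hHP ?_).trans (le_measure_sdiff)
    refine (measure_biUnion_finset_le _ _).trans ?_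
    refine (Finset.sum_le_card_nsmul _ _ _ fun a _ => hWP a).trans_eq ?_
    rw [nsmul_eq_mul, ENNReal.ofReal_mul (by positivity), ENNReal.ofReal_natCast]
  rw [ENNReal.ofReal_mul (by positivity)]
  calc _ ≤ ENNReal.ofReal (ε ^ s) * P K := by gcongr
    _ = ∫⁻ ω, K.indicator (fun _ => ENNReal.ofReal (ε ^ s)) ω ∂P :=
        (lintegral_indicator_const hKm _).symm
    _ ≤ _ := by
        refine lintegral_mono_ae ?_
        filter_upwards [hgood] with ω hg
        by_cases hω : ω ∈ K
        swap
        · rw [Set.indicator_of_notMem hω]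
          exact zero_le
        rw [Set.indicator_of_mem hω]
        refine le_iInf₂ fun a ha => ?_
        rw [← ENNReal.ofReal_rpow_of_pos hε]
        refine ENNReal.rpow_le_rpow ?_ hs.le
        by_contra hlt
        exact hω.2 (Set.mem_biUnion ha (hW a ω hω.1 hg (not_le.1 hlt).le))

end LowerBound

/-! ### Asymptotics at the critical number of jumps -/

section Asymptotics

theorem tendsto_log_div_self : Tendsto (fun r : ℝ => Real.log r / r) atTop (𝓝 0) :=
  Real.isLittleO_log_id_atTop.tendsto_div_nhds_zero

theorem tendsto_mul_log_atTop : Tendsto (fun r : ℝ => r * Real.log r) atTop atTop :=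
  tendsto_id.atTop_mul_atTop₀ Real.tendsto_log_atTop

theorem tendsto_sqrt_mul_log_atTop : Tendsto (fun r : ℝ => √(r * Real.log r)) atTop atTop :=
  Real.tendsto_sqrt_atTop.comp tendsto_mul_log_atTop

/-- The number of jumps that dominates the quantization error at rate `r`, up to the factor `A`. -/
noncomputable def criticalJumps (A r : ℝ) : ℕ := ⌈A * √(r / Real.log r)⌉₊

theorem tendsto_div_log_atTop : Tendsto (fun r : ℝ => r / Real.log r) atTop atTop := by
  have h : Tendsto (fun r : ℝ => Real.log r / r) atTop (𝓝[>] 0) := by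
    refine tendsto_nhdsWithin_iff.2 ⟨tendsto_log_div_self, ?_⟩
    filter_upwards [eventually_gt_atTop 1] with r hr
    exact div_pos (Real.log_pos hr) (by linarith)
  exact h.inv_tendsto_nhdsGT_zero.congr fun r => by simp

variable {A : ℝ}

theorem tendsto_mul_sqrt_div_log_atTop (hA : 0 < A) :
    Tendsto (fun r : ℝ => A * √(r / Real.log r)) atTop atTop :=
  (Real.tendsto_sqrt_atTop.comp tendsto_div_log_atTop).const_mul_atTop hA

theorem tendsto_criticalJumps_div (hA : 0 < A) :
    Tendsto (fun r : ℝ => (criticalJumps A r : ℝ) / (A * √(r / Real.log r))) atTop (𝓝 1) :=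
  (tendsto_nat_ceil_div_atTop (R := ℝ)).comp (tendsto_mul_sqrt_div_log_atTop hA)

theorem sqrt_mul_self_log {r : ℝ} (hr : 1 < r) :
    √(r * Real.log r) = √(r / Real.log r) * Real.log r := by
  have hL := Real.log_pos hr
  rw [← Real.sqrt_sq hL.le, ← Real.sqrt_mul (by positivity), Real.sqrt_sq hL.le]
  congr 1
  field_simp

theorem tendsto_div_criticalJumps (hA : 0 < A) :
    Tendsto (fun r : ℝ => r / criticalJumps A r / √(r * Real.log r)) atTop (𝓝 (1 / A)) := by
  have h := ((tendsto_criticalJumps_div hA).inv₀ one_ne_zero).mul_const (1 / A)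
  rw [inv_one, one_mul] at h
  refine h.congr' ?_
  filter_upwards [eventually_gt_atTop 1] with r hr
  have hL := Real.log_pos hr
  have hq : 0 < √(r / Real.log r) := Real.sqrt_pos.2 (by positivity)
  have hq2 : √(r / Real.log r) * √(r / Real.log r) * Real.log r = r := by
    rw [Real.mul_self_sqrt (by positivity)]
    field_simp
  have hn : 0 < (criticalJumps A r : ℝ) := by
    exact_mod_cast Nat.ceil_pos.2 (by positivity)
  rw [sqrt_mul_self_log hr]
  nth_rewrite 4 [← hq2]
  field_simp

/-- The ceiling, the factor `A` and `log log r` are of lower order, so only the square root of `r`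
matters. -/
theorem tendsto_log_criticalJumps_div_log (hA : 0 < A) :
    Tendsto (fun r : ℝ => Real.log (criticalJumps A r) / Real.log r) atTop (𝓝 (1 / 2)) := by
  have h1 : Tendsto (fun r : ℝ => (Real.log ((criticalJumps A r : ℝ) / (A * √(r / Real.log r))) +
      Real.log A) / Real.log r) atTop (𝓝 0) :=
    (((tendsto_criticalJumps_div hA).log one_ne_zero).add_const _).div_atTop
      Real.tendsto_log_atTop
  have h2 : Tendsto (fun r : ℝ => Real.log (Real.log r) / Real.log r) atTop (𝓝 0) :=
    tendsto_log_div_self.comp Real.tendsto_log_atTop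
  have h := (h1.add (tendsto_const_nhds (x := (1 / 2 : ℝ)))).sub (h2.mul_const (1 / 2))
  rw [zero_mul, zero_add, sub_zero] at h
  refine h.congr' ?_
  filter_upwards [eventually_gt_atTop 1] with r hr
  have hL := Real.log_pos hr
  have hq : 0 < √(r / Real.log r) := Real.sqrt_pos.2 (by positivity)
  have hn : 0 < (criticalJumps A r : ℝ) := by
    exact_mod_cast Nat.ceil_pos.2 (by positivity)
  rw [Real.log_div hn.ne' (by positivity), Real.log_mul hA.ne' hq.ne', Real.log_sqrt (by positivity),
    Real.log_div (by positivity) hL.ne']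
  field_simp
  ring

theorem tendsto_log_div_sqrt_mul_log :
    Tendsto (fun r : ℝ => Real.log r / √(r * Real.log r)) atTop (𝓝 0) := by
  have h : Tendsto (fun r : ℝ => √(Real.log r / r)) atTop (𝓝 0) := by
    simpa using tendsto_log_div_self.sqrt
  refine h.congr' ?_
  filter_upwards [eventually_gt_atTop 1] with r hr
  have hL := Real.log_pos hr
  have h0 : 0 < r := by linarith
  rw [eq_div_iff (by positivity), ← Real.sqrt_mul (by positivity)]
  rw [show Real.log r / r * (r * Real.log r) = Real.log r ^ 2 by field_simp, Real.sqrt_sq hL.le]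

theorem tendsto_log_criticalJumps_div (hA : 0 < A) :
    Tendsto (fun r : ℝ => Real.log (criticalJumps A r) / √(r * Real.log r)) atTop (𝓝 0) := by
  have h := (tendsto_log_criticalJumps_div_log hA).mul tendsto_log_div_sqrt_mul_log
  rw [mul_zero] at h
  refine h.congr' ?_
  filter_upwards [eventually_gt_atTop 1] with r hr
  have hL := Real.log_pos hr
  field_simp

theorem tendsto_criticalJumps_div_mul_log (hA : 0 < A) :
    Tendsto (fun r : ℝ => criticalJumps A r * Real.log r / √(r * Real.log r)) atTop (𝓝 A) := by
  have h := (tendsto_criticalJumps_div hA).mul_const A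
  rw [one_mul] at h
  refine h.congr' ?_
  filter_upwards [eventually_gt_atTop 1] with r hr
  have hL := Real.log_pos hr
  have hq : 0 < √(r / Real.log r) := Real.sqrt_pos.2 (by positivity)
  rw [sqrt_mul_self_log hr]
  field_simp

theorem tendsto_criticalJumps_mul_log (hA : 0 < A) :
    Tendsto (fun r : ℝ => criticalJumps A r * Real.log (criticalJumps A r) / √(r * Real.log r))
      atTop (𝓝 (A / 2)) := by
  have h := (tendsto_criticalJumps_div_mul_log hA).mul (tendsto_log_criticalJumps_div_log hA)
  rw [mul_one_div] at h
  refine h.congr' ?_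
  filter_upwards [eventually_gt_atTop 1] with r hr
  have hL := Real.log_pos hr
  field_simp

theorem tendsto_criticalJumps_div_sqrt (hA : 0 < A) :
    Tendsto (fun r : ℝ => criticalJumps A r / √(r * Real.log r)) atTop (𝓝 0) := by
  have h := (tendsto_criticalJumps_div_mul_log hA).div_atTop Real.tendsto_log_atTop
  refine h.congr' ?_
  filter_upwards [eventually_gt_atTop 1] with r hr
  have hL := Real.log_pos hr
  field_simp

/-- The logarithm of the `ε` for which balls of radius `ε` are too small to cover. -/
noncomputable def logRadius (β b c A r : ℝ) : ℝ :=
  -(1 / β) * (r / criticalJumps A r + β * Real.log (criticalJumps A r) + b - Real.log c)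

theorem tendsto_logRadius (β b c : ℝ) (hA : 0 < A) :
    Tendsto (fun r => logRadius β b c A r / √(r * Real.log r)) atTop (𝓝 (-(1 / β) * (1 / A))) := by
  have h := (((tendsto_div_criticalJumps hA).add
    ((tendsto_log_criticalJumps_div hA).const_mul β)).add
    (tendsto_const_nhds (x := b - Real.log c).div_atTop tendsto_sqrt_mul_log_atTop)).const_mul
    (-(1 / β))
  rw [mul_zero, add_zero, add_zero] at h
  refine h.congr fun r => ?_
  rw [logRadius]
  ring

/-- The exponent in the lower bound for the `s`-th power of the quantization error. -/
noncomputable def lowerExponent (s β b c A r : ℝ) : ℝ :=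
  s * logRadius β b c A r -
    criticalJumps A r * (Real.log (criticalJumps A r) - Real.log c) - Real.log 2

/-- With a general factor `A`, the exponent per `√(r log r)` tends to `-(s / (β A) + A / 2)`. The
choice `A = √(2s/β)` balances the two terms, minimizes their sum and makes it equal to `A`. -/
theorem tendsto_lowerExponent {s β : ℝ} (b c : ℝ) (hs : 0 < s) (hβ : 0 < β) :
    Tendsto (fun r => -lowerExponent s β b c (√(2 * s / β)) r / (√(2 * s / β) * √(r * Real.log r)))
      atTop (𝓝 1) := by
  have hA : 0 < √(2 * s / β) := Real.sqrt_pos.2 (by positivity)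
  have hA2 : √(2 * s / β) * √(2 * s / β) = 2 * s / β := Real.mul_self_sqrt (by positivity)
  generalize √(2 * s / β) = A at *
  have h := (((((tendsto_logRadius β b c hA).const_mul s).sub
    (tendsto_criticalJumps_mul_log hA)).add
    ((tendsto_criticalJumps_div_sqrt hA).mul_const (Real.log c))).sub
    (tendsto_const_nhds (x := Real.log 2).div_atTop tendsto_sqrt_mul_log_atTop)).neg.div_const A
  have hlim : -(s * (-(1 / β) * (1 / A)) - A / 2 + 0 * Real.log c - 0) / A = 1 := by
    field_simp
    field_simp at hA2
    linarith
  rw [hlim] at h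
  refine h.congr fun r => ?_
  rw [lowerExponent, mul_comm A, ← div_div]
  congr 1
  ring

end Asymptotics

/-! ### The limsup bound -/

section LowerBoundRate

variable {Ω : Type*} [MeasurableSpace Ω] {P : Measure Ω} [IsProbabilityMeasure P]
  {d : ℕ} {lam s : ℝ} {e : ℕ → Ω → ℝ} {Z : ℕ → Ω → Fin d → ℝ} {X : Ω → StepPath (Fin d → ℝ)}

/-- `logRadius` solves for the `ε` at which the mass caught by `exp r` codewords is at most half of
`(c / n) ^ n`, so that `le_lintegral_min` leaves `ε ^ s * (c / n) ^ n / 2`. -/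
theorem eventually_le_quantError (hlam : 0 < lam) (hs : 0 < s)
    (hX : IsCompoundPoisson P lam e Z X) (hac : HasACComponent (P.map (Z 0))) :
    ∃ b c : ℝ, ∀ᶠ r : ℝ in atTop,
      ENNReal.ofReal (Real.exp (lowerExponent s (1 + d) b c (√(2 * s / (1 + d))) r / s)) ≤
        quantError P X pathDist s r := by
  obtain ⟨c, hc, C, hC, hmain⟩ := le_lintegral_min hlam hs hX hac
  -- The summand `log 2` produces a factor `(1 / 2) ^ n ≤ 1 / 2` in the mass caught by the
  -- codewords.
  refine ⟨Real.log C + Real.log 2, c, ?_⟩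
  have hβ : (0 : ℝ) < 1 + d := by positivity
  have hA : 0 < √(2 * s / (1 + d)) := Real.sqrt_pos.2 (by positivity)
  generalize √(2 * s / (1 + d)) = A at *
  set b := Real.log C + Real.log 2 with hb
  -- This is the requirement `ε ≤ c / n`. It holds eventually because `log ε` is negative of order
  -- `√(r log r)`, while `log n` is of smaller order.
  have hsmall : ∀ᶠ r : ℝ in atTop,
      logRadius (1 + d) b c A r ≤ Real.log c - Real.log (criticalJumps A r) := by
    have h1 := (tendsto_logRadius (1 + d) b c hA).add ((tendsto_log_criticalJumps_div hA).sub
      (tendsto_const_nhds (x := Real.log c).div_atTop tendsto_sqrt_mul_log_atTop))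
    have h2 : -(1 / (1 + (d : ℝ))) * (1 / A) + (0 - 0) < 0 := by
      have : 0 < 1 / (1 + (d : ℝ)) * (1 / A) := by positivity
      linarith
    filter_upwards [h1.eventually_lt_const h2,
      tendsto_sqrt_mul_log_atTop.eventually_gt_atTop 0] with r hr hq
    rw [← sub_div, ← add_div, div_lt_iff₀ hq, zero_mul] at hr
    linarith
  filter_upwards [hsmall, eventually_gt_atTop 1] with r hε hr
  have hL := Real.log_pos hr
  have hn1 : 1 ≤ criticalJumps A r := Nat.ceil_pos.2 (by positivity)
  have hn0 : (0 : ℝ) < criticalJumps A r := by exact_mod_cast hn1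
  rw [lowerExponent]
  have hrad : (1 + d) * logRadius (1 + d) b c A r = -(r / criticalJumps A r +
      (1 + d) * Real.log (criticalJumps A r) + b - Real.log c) := by
    rw [logRadius]
    field_simp
  generalize logRadius (1 + d) b c A r = ℓ at *
  generalize criticalJumps A r = n at *
  refine le_iInf fun B => le_iInf fun hB => le_iInf fun hBr => ?_
  have hcard : (B.card : ℝ) ≤ Real.exp r :=
    (Real.log_le_iff_le_exp (by exact_mod_cast hB.card_pos)).1 hBr
  have hεn : Real.exp ℓ ≤ c / n := by
    rw [← Real.le_log_iff_exp_le (by positivity), Real.log_div hc.ne' hn0.ne']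
    exact hε
  have hpow : (C * n ^ d * Real.exp ℓ ^ (1 + d)) ^ n =
      Real.exp (-r) * ((c / n) ^ n * (1 / 2) ^ n) := by
    have h1 : C * n ^ d * Real.exp ℓ ^ (1 + d) = Real.exp (-r / n) * (c / n * (1 / 2)) := by
      refine Real.log_injOn_pos (Set.mem_Ioi.2 (by positivity)) (Set.mem_Ioi.2 (by positivity)) ?_
      rw [Real.log_mul (by positivity) (by positivity), Real.log_mul (by positivity) (by positivity),
        Real.log_pow, Real.log_pow, Real.log_exp, Real.log_mul (by positivity) (by positivity),
        Real.log_exp, Real.log_mul (by positivity) (by positivity),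
        Real.log_div hc.ne' hn0.ne', one_div, Real.log_inv]
      push_cast
      rw [hrad, hb]
      ring
    rw [h1, mul_pow, ← Real.exp_nat_mul, mul_pow]
    congr 2
    field_simp
  have hhalf : ((1 : ℝ) / 2) ^ n ≤ 1 / 2 :=
    pow_le_of_le_one (by norm_num) (by norm_num) (by omega)
  have hlow : (c / n) ^ n * (1 / 2) ≤
      (c / n) ^ n - B.card * (C * n ^ d * Real.exp ℓ ^ (1 + d)) ^ n := by
    have h1 : B.card * (C * n ^ d * Real.exp ℓ ^ (1 + d)) ^ n ≤ (c / n) ^ n * (1 / 2) := by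
      rw [hpow]
      calc _ ≤ Real.exp r * (Real.exp (-r) * ((c / n) ^ n * (1 / 2))) := by gcongr
        _ = _ := by rw [← mul_assoc, ← Real.exp_add, add_neg_cancel, Real.exp_zero, one_mul]
    linarith
  have hkey := hmain n hn1 (Real.exp ℓ) (Real.exp_pos _) hεn B
  refine le_trans ?_ (ENNReal.rpow_le_rpow ((ENNReal.ofReal_le_ofReal
    (mul_le_mul_of_nonneg_left hlow (by positivity))).trans hkey) (by positivity))
  rw [ENNReal.ofReal_rpow_of_pos (by positivity)]
  refine ENNReal.ofReal_le_ofReal (le_of_eq ?_)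
  refine Real.log_injOn_pos (Set.mem_Ioi.2 (by positivity)) (Set.mem_Ioi.2 (by positivity)) ?_
  rw [Real.log_exp, Real.log_rpow (by positivity), Real.log_mul (by positivity) (by positivity),
    Real.log_rpow (by positivity), Real.log_exp, Real.log_mul (by positivity) (by positivity),
    Real.log_pow, Real.log_div hc.ne' hn0.ne', one_div, one_div, Real.log_inv]
  ring

theorem sqrt_two_div_mul {β L : ℝ} (hs : 0 < s) (hβ : 0 < β) :
    √(2 / (s * β) * L) = √(2 * s / β) * √L / s := by
  rw [show 2 / (s * β) * L = 2 * s / β * L / s ^ 2 by field_simp,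
    Real.sqrt_div' _ (sq_nonneg s), Real.sqrt_sq hs.le, Real.sqrt_mul (by positivity)]

theorem limsup_neg_log_quantError_le (hlam : 0 < lam) (hs : 0 < s)
    (hX : IsCompoundPoisson P lam e Z X) (hac : HasACComponent (P.map (Z 0))) :
    limsup (fun r : ℝ => -ENNReal.log (quantError P X pathDist s r) /
        ((Real.sqrt (2 / (s * (1 + d)) * (r * Real.log r)) : ℝ) : EReal)) atTop ≤ 1 := by
  have hβ : (0 : ℝ) < 1 + d := by positivity
  obtain ⟨b, c, hbc⟩ := eventually_le_quantError hlam hs hX hac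
  have hlim := (continuous_coe_real_ereal.tendsto (1 : ℝ)).comp (tendsto_lowerExponent b c hs hβ)
  refine le_trans (limsup_le_limsup ?_) hlim.limsup_eq.le
  filter_upwards [hbc, tendsto_sqrt_mul_log_atTop.eventually_gt_atTop 0] with r hr hq
  have h1 : -ENNReal.log (quantError P X pathDist s r) ≤
      ((-(lowerExponent s (1 + d) b c (√(2 * s / (1 + d))) r / s) : ℝ) : EReal) := by
    rw [EReal.coe_neg, EReal.neg_le_neg_iff, ← Real.log_exp (_ / s),
      ← ENNReal.log_ofReal_of_pos (Real.exp_pos _)]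
    exact ENNReal.log_le_log hr
  refine (EReal.div_le_div_right_of_nonneg (by exact_mod_cast Real.sqrt_nonneg _) h1).trans ?_
  rw [← EReal.coe_div, sqrt_two_div_mul hs hβ]
  simp only [Function.comp]
  rw [EReal.coe_le_coe_iff]
  apply le_of_eq
  have hA : 0 < √(2 * s / (1 + d)) := Real.sqrt_pos.2 (by positivity)
  field_simp

end LowerBoundRate

/-! ### Codebooks for a given number of jumps -/

section UpperBound

/-- Dropping the factor `exp (-x) ≤ 1` of the density leaves `θ⁻¹` times the exponential density of
rate `θ`. -/
theorem lintegral_exp_neg_mul_expMeasure_le {θ : ℝ} (hθ : 0 < θ) :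
    ∫⁻ x, ENNReal.ofReal (Real.exp (-(θ * x))) ∂(expMeasure 1) ≤ ENNReal.ofReal θ⁻¹ := by
  change ∫⁻ x, ENNReal.ofReal (Real.exp (-(θ * x))) ∂(volume.withDensity (exponentialPDF 1)) ≤ _
  have hm : ∀ r, Measurable (exponentialPDF r) :=
    fun r => (measurable_exponentialPDFReal r).ennreal_ofReal
  rw [lintegral_withDensity_eq_lintegral_mul _ (hm 1) (by fun_prop)]
  calc _ ≤ ∫⁻ x, ENNReal.ofReal θ⁻¹ * exponentialPDF θ x := by
        refine lintegral_mono fun x => ?_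
        simp only [Pi.mul_apply, exponentialPDF_eq]
        split_ifs with h
        · rw [← ENNReal.ofReal_mul (by positivity), ← ENNReal.ofReal_mul (by positivity),
            inv_mul_cancel_left₀ hθ.ne', one_mul, one_mul]
          refine ENNReal.ofReal_le_ofReal (mul_le_of_le_one_left (Real.exp_pos _).le ?_)
          exact Real.exp_le_one_iff.2 (by linarith)
        · simp
    _ = _ := by rw [lintegral_const_mul _ (hm θ), lintegral_exponentialPDF_eq_one hθ, mul_one]

/-- Each of the `2 * t.card` terms is at most the `1/s`-th power of the sum on the right. No
convexity is involved, so all `s > 0` are covered at once. -/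
theorem sum_add_rpow_le {ι : Type*} (t : Finset ι) (a b : ι → ℝ≥0∞) {s : ℝ} (hs : 0 < s) :
    (∑ i ∈ t, (a i + b i)) ^ s ≤ (2 * t.card : ℝ≥0∞) ^ s * ∑ i ∈ t, (a i ^ s + b i ^ s) := by
  set T := ∑ i ∈ t, (a i ^ s + b i ^ s) with hT
  have h : ∀ i ∈ t, a i + b i ≤ 2 * T ^ s⁻¹ := by
    intro i hi
    have h1 : a i ^ s + b i ^ s ≤ T :=
      Finset.single_le_sum (f := fun i => a i ^ s + b i ^ s) (fun _ _ => zero_le) hi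
    rw [two_mul]
    exact add_le_add ((ENNReal.le_rpow_inv_iff hs).2 (le_self_add.trans h1))
      ((ENNReal.le_rpow_inv_iff hs).2 (le_add_self.trans h1))
  have h2 : ∑ i ∈ t, (a i + b i) ≤ 2 * t.card * T ^ s⁻¹ := by
    refine (Finset.sum_le_card_nsmul _ _ _ h).trans_eq ?_
    rw [nsmul_eq_mul]
    ring
  refine (ENNReal.rpow_le_rpow h2 hs.le).trans_eq ?_
  rw [ENNReal.mul_rpow_of_nonneg _ _ hs.le, ← ENNReal.rpow_mul, inv_mul_cancel₀ hs.ne',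
    ENNReal.rpow_one]

/-- The event that the path has exactly `n` jumps in `[0,1[`. -/
def jumpEvent {Ω : Type*} (lam : ℝ) (e : ℕ → Ω → ℝ) (n : ℕ) : Set Ω :=
  {ω | ∑ i ∈ Finset.range n, e i ω < lam ∧ lam ≤ ∑ i ∈ Finset.range (n + 1), e i ω}

/-- The step paths with `n` jumps, at times in `{0, 1/m, ..., (m-1)/m}` and with heights
in `C`. -/
noncomputable def gridCodebook {E : Type*} [AddCommMonoid E] (n m : ℕ) (C : Finset E) :
    Finset (StepPath E) :=
  letI := Classical.decEq (StepPath E)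
  (Finset.univ : Finset (Fin n → Fin m × C)).image fun g =>
    jumpPath n (fun i => if h : i < n then ((g ⟨i, h⟩).1 : ℝ) / m else 0)
      (fun i => if h : i < n then ((g ⟨i, h⟩).2 : E) else 0)

theorem card_gridCodebook_le {E : Type*} [AddCommMonoid E] (n m : ℕ) (C : Finset E) :
    (gridCodebook n m C).card ≤ (m * C.card) ^ n := by
  let := Classical.decEq (StepPath E)
  refine Finset.card_image_le.trans_eq ?_
  simp

theorem jumpPath_congr {E : Type*} [AddCommMonoid E] {n : ℕ} {τ τ' : ℕ → ℝ} {z z' : ℕ → E}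
    (h1 : ∀ i < n, τ i = τ' i) (h2 : ∀ i < n, z i = z' i) :
    jumpPath n τ z = jumpPath n τ' z' := by
  refine Subtype.ext (funext fun t => ?_)
  simp only [jumpPath]
  refine Finset.sum_congr rfl fun i hi => ?_
  rw [h1 i (Finset.mem_range.1 hi), h2 i (Finset.mem_range.1 hi)]

theorem jumpPath_mem_gridCodebook {E : Type*} [AddCommMonoid E] {n m : ℕ} {C : Finset E}
    {k : ℕ → ℕ} {z : ℕ → E} (hk : ∀ i < n, k i < m) (hz : ∀ i < n, z i ∈ C) :
    jumpPath n (fun i => (k i : ℝ) / m) z ∈ gridCodebook n m C := by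
  classical
  refine Finset.mem_image.2 ⟨fun i => (⟨k i, hk i i.2⟩, ⟨z i, hz i i.2⟩), Finset.mem_univ _, ?_⟩
  exact jumpPath_congr (fun i hi => by simp [hi]) (fun i hi => by simp [hi])

theorem jumpPath_zero_right {E : Type*} [AddCommMonoid E] (n : ℕ) (τ τ' : ℕ → ℝ) (z : ℕ → E) :
    jumpPath n τ (fun _ => (0 : E)) = jumpPath 0 τ' z := by
  refine Subtype.ext (funext fun t => ?_)
  simp [jumpPath]

section Paths

variable {Ω E : Type*} [NormedAddCommGroup E] {lam s : ℝ} {e : ℕ → Ω → ℝ} {Z : ℕ → Ω → E}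

theorem eq_jumpPath_of_mem_jumpEvent (hlam : 0 < lam) {ω : Ω} (he : ∀ i, 0 ≤ e i ω) {f : StepPath E}
    (hf : ∀ t : Set.Ico (0 : ℝ) 1,
      f.1 t = ∑ i ∈ Finset.range (countingProcess lam e (t : ℝ) ω), Z i ω)
    {n : ℕ} (hn : ω ∈ jumpEvent lam e n) :
    f = jumpPath n (fun i => (∑ j ∈ Finset.range (i + 1), e j ω) / lam) fun i => Z i ω :=
  Subtype.ext (funext fun t => by
    rw [hf t, sum_range_countingProcess hlam he hn.2 (fun i => Z i ω) t.2.1 t.2.2]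
    rfl)

/-- Jump times are rounded down to multiples of `1 / m`, and each height is replaced by its best
codeword. Rounding down keeps the grid index below `m`, as the jumps occur before time `1`. -/
theorem exists_mem_gridCodebook (hs : 0 < s) (hlam : 0 < lam) {ω : Ω}
    (he : ∀ i, 0 ≤ e i ω) {f : StepPath E}
    (hf : ∀ t : Set.Ico (0 : ℝ) 1,
      f.1 t = ∑ i ∈ Finset.range (countingProcess lam e (t : ℝ) ω), Z i ω)
    {n : ℕ} (hn : ω ∈ jumpEvent lam e n) {m : ℕ} (hm : 0 < m) {C : Finset E} (hC : C.Nonempty) :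
    ∃ a ∈ gridCodebook n m C, pathDist f a ^ s ≤ (2 * n : ℝ≥0∞) ^ s *
      ∑ i ∈ Finset.range n, ((⨅ z ∈ C, normDist (Z i ω) z ^ s) +
        (ENNReal.ofReal (1 / m)) ^ s * ‖Z i ω‖ₑ ^ s) := by
  have hm0 : (0 : ℝ) < m := by exact_mod_cast hm
  rw [eq_jumpPath_of_mem_jumpEvent hlam he hf hn]
  set τ : ℕ → ℝ := fun i => (∑ j ∈ Finset.range (i + 1), e j ω) / lam
  have hτ0 : ∀ i, 0 ≤ τ i := fun i => div_nonneg (Finset.sum_nonneg fun j _ => he j) hlam.le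
  have hτ1 : ∀ i < n, τ i < 1 := fun i hi => by
    rw [div_lt_one hlam]
    exact (sum_range_mono he (show i + 1 ≤ n from hi)).trans_lt hn.1
  have hmin : ∀ i, ∃ z ∈ C, normDist (Z i ω) z ^ s = ⨅ z ∈ C, normDist (Z i ω) z ^ s := by
    intro i
    obtain ⟨z, hz, hz'⟩ := C.exists_min_image (fun z => normDist (Z i ω) z ^ s) hC
    exact ⟨z, hz, le_antisymm (le_iInf₂ hz') (iInf₂_le z hz)⟩
  choose z hzC hz using hmin
  refine ⟨_, jumpPath_mem_gridCodebook (k := fun i => ⌊m * τ i⌋₊) (z := z) (fun i hi => ?_)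
    fun i _ => hzC i, ?_⟩
  · rw [Nat.floor_lt (by have := hτ0 i; positivity)]
    have := hτ1 i hi
    nlinarith
  · have hd := pathDist_jumpPath_le (n := n) (τ := τ) (τ' := fun i => (⌊m * τ i⌋₊ : ℝ) / m)
      (h := 1 / m) (fun i => Z i ω) z (fun i _ => ?_) fun i _ => ?_
    · refine (ENNReal.rpow_le_rpow hd hs.le).trans ((sum_add_rpow_le _ _ _ hs).trans_eq ?_)
      rw [Finset.card_range]
      congr 1
      refine Finset.sum_congr rfl fun i _ => ?_
      rw [ENNReal.mul_rpow_of_nonneg _ _ hs.le, mul_comm (‖Z i ω‖ₑ ^ s), ← hz i]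
      rfl
    · rw [div_le_iff₀ hm0, mul_comm]
      exact Nat.floor_le (by have := hτ0 i; positivity)
    · rw [← add_div, le_div_iff₀ hm0, mul_comm]
      exact (Nat.lt_floor_add_one _).le

/-- The zero path is viewed as having the same `n` jump times with zero heights, so
`pathDist_jumpPath_le` applies with no delay. -/
theorem pathDist_zero_le (hs : 0 < s) (hlam : 0 < lam) {ω : Ω}
    (he : ∀ i, 0 ≤ e i ω) {f : StepPath E}
    (hf : ∀ t : Set.Ico (0 : ℝ) 1,
      f.1 t = ∑ i ∈ Finset.range (countingProcess lam e (t : ℝ) ω), Z i ω)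
    {n : ℕ} (hn : ω ∈ jumpEvent lam e n) (τ : ℕ → ℝ) (z : ℕ → E) :
    pathDist f (jumpPath 0 τ z) ^ s ≤ (2 * n : ℝ≥0∞) ^ s *
      ∑ i ∈ Finset.range n, ‖Z i ω‖ₑ ^ s := by
  rw [eq_jumpPath_of_mem_jumpEvent hlam he hf hn, ← jumpPath_zero_right n
    (fun i => (∑ j ∈ Finset.range (i + 1), e j ω) / lam) τ z]
  refine (ENNReal.rpow_le_rpow (pathDist_jumpPath_le (h := 0) _ _ (fun i _ => le_rfl)
    fun i _ => by simp) hs.le).trans ((sum_add_rpow_le _ _ _ hs).trans_eq ?_)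
  rw [Finset.card_range]
  simp [hs]

end Paths

/-- A finite codebook is bounded, so a finite quantization error forces a finite `s`-th moment. This
is why no moment assumption on the jump heights is needed. -/
theorem lintegral_enorm_rpow_ne_top {Ω E : Type*} [MeasurableSpace Ω]
    [NormedAddCommGroup E] {P : Measure Ω} {s : ℝ} [IsProbabilityMeasure P] {Y : Ω → E} (hs : 0 < s)
    {C : Finset E} {ε : ℝ} (hC : C.Nonempty)
    (h : ∫⁻ ω, ⨅ z ∈ C, normDist (Y ω) z ^ s ∂P ≤ ENNReal.ofReal ε) :
    ∫⁻ ω, ‖Y ω‖ₑ ^ s ∂P ≠ ∞ := by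
  set R : ℝ≥0∞ := ∑ z ∈ C, ‖z‖ₑ ^ s with hR
  have hRtop : R ≠ ∞ := ENNReal.sum_ne_top.2 fun z _ =>
    ENNReal.rpow_ne_top_of_nonneg hs.le enorm_ne_top
  have hpt : ∀ ω, ‖Y ω‖ₑ ^ s ≤ 2 ^ s * ((⨅ z ∈ C, normDist (Y ω) z ^ s) + R) := by
    intro ω
    obtain ⟨z, hz, hz'⟩ := C.exists_min_image (fun z => normDist (Y ω) z ^ s) hC
    rw [le_antisymm (iInf₂_le z hz) (le_iInf₂ hz')]
    have h1 : ‖Y ω‖ₑ ≤ ∑ i ∈ ({z} : Finset E), (‖Y ω - i‖ₑ + ‖i‖ₑ) := by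
      rw [Finset.sum_singleton]
      calc ‖Y ω‖ₑ = ‖(Y ω - z) + z‖ₑ := by rw [sub_add_cancel]
        _ ≤ _ := enorm_add_le _ _
    refine (ENNReal.rpow_le_rpow h1 hs.le).trans ((sum_add_rpow_le _ _ _ hs).trans ?_)
    rw [Finset.sum_singleton, Finset.card_singleton, Nat.cast_one, mul_one]
    gcongr
    · exact le_rfl
    · exact Finset.single_le_sum (f := fun z => ‖z‖ₑ ^ s) (fun _ _ => zero_le) hz
  refine ne_top_of_le_ne_top ?_ (lintegral_mono hpt)
  rw [lintegral_const_mul' _ _ (ENNReal.rpow_ne_top_of_nonneg hs.le (by simp)),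
    lintegral_add_right _ measurable_const, lintegral_const, measure_univ, mul_one]
  exact ENNReal.mul_ne_top (ENNReal.rpow_ne_top_of_nonneg hs.le (by simp))
    (ENNReal.add_ne_top.2 ⟨ne_top_of_le_ne_top ENNReal.ofReal_ne_top h, hRtop⟩)

variable {Ω E : Type*} [MeasurableSpace Ω] [NormedAddCommGroup E] [MeasurableSpace E]
  {P : Measure Ω} {lam s : ℝ} {e : ℕ → Ω → ℝ} {Z : ℕ → Ω → E} {X : Ω → StepPath E}

namespace IsCompoundPoisson

theorem measurableSet_jumpEvent (hX : IsCompoundPoisson P lam e Z X) (n : ℕ) :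
    MeasurableSet (jumpEvent lam e n) := by
  have h : ∀ k, Measurable fun ω => ∑ i ∈ Finset.range k, e i ω :=
    fun k => Finset.measurable_fun_sum _ fun i _ => hX.measurable_e i
  exact (measurableSet_lt (h n) measurable_const).inter (measurableSet_le measurable_const (h _))

/-- Chernoff's bound `exp (θ * lam) * θ⁻¹ ^ n`, taken at its minimizer `θ = n / lam`. -/
theorem measure_sum_lt_le (hX : IsCompoundPoisson P lam e Z X) (hlam : 0 < lam) (n : ℕ) :
    P {ω | ∑ i ∈ Finset.range n, e i ω < lam} ≤
      ENNReal.ofReal ((lam * Real.exp 1 / n) ^ n) := by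
  have hprob := hX.iIndep_e.isProbabilityMeasure
  rcases Nat.eq_zero_or_pos n with rfl | hn
  · simpa using prob_le_one
  have hn0 : (0 : ℝ) < n := by exact_mod_cast hn
  set θ : ℝ := n / lam with hθ
  have hθ0 : 0 < θ := by positivity
  have hm : Measurable fun x : ℝ => ENNReal.ofReal (Real.exp (-(θ * x))) := by fun_prop
  have hS : MeasurableSet {ω | ∑ i ∈ Finset.range n, e i ω < lam} :=
    measurableSet_lt (Finset.measurable_fun_sum _ fun i _ => hX.measurable_e i) measurable_const
  calc P {ω | ∑ i ∈ Finset.range n, e i ω < lam}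
      = ∫⁻ ω, {ω | ∑ i ∈ Finset.range n, e i ω < lam}.indicator 1 ω ∂P :=
        (lintegral_indicator_one hS).symm
    _ ≤ ∫⁻ ω, ENNReal.ofReal (Real.exp n) *
          ∏ i ∈ Finset.range n, ENNReal.ofReal (Real.exp (-(θ * e i ω))) ∂P := by
        refine lintegral_mono fun ω => ?_
        by_cases hω : ω ∈ {ω | ∑ i ∈ Finset.range n, e i ω < lam}
        · rw [Set.indicator_of_mem hω, Pi.one_apply,
            ← ENNReal.ofReal_prod_of_nonneg fun _ _ => (Real.exp_pos _).le, ← Real.exp_sum,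
            ← ENNReal.ofReal_mul (Real.exp_pos _).le, ← Real.exp_add, ENNReal.one_le_ofReal,
            Real.one_le_exp_iff, Finset.sum_neg_distrib, ← Finset.mul_sum]
          have h1 : θ * ∑ i ∈ Finset.range n, e i ω ≤ θ * lam :=
            mul_le_mul_of_nonneg_left (le_of_lt hω) hθ0.le
          rw [hθ, div_mul_cancel₀ _ hlam.ne'] at h1
          linarith
        · rw [Set.indicator_of_notMem hω]
          exact zero_le
    _ = ENNReal.ofReal (Real.exp n) *
          ∏ i ∈ Finset.range n, ∫⁻ ω, ENNReal.ofReal (Real.exp (-(θ * e i ω))) ∂P := by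
        have hme : ∀ i, Measurable fun ω => ENNReal.ofReal (Real.exp (-(θ * e i ω))) :=
          fun i => hm.comp (hX.measurable_e i)
        rw [lintegral_const_mul _ (Finset.measurable_fun_prod _ fun i _ => hme i)]
        congr 1
        exact lintegral_prod_eq_prod_lintegral_of_indepFun _ _ (hX.iIndep_e.comp _ fun _ => hm)
          fun i => hm.comp (hX.measurable_e i)
    _ ≤ ENNReal.ofReal (Real.exp n) * ENNReal.ofReal θ⁻¹ ^ n := by
        gcongr
        refine (Finset.prod_le_pow_card _ _ _ fun i _ => ?_).trans_eq (by rw [Finset.card_range])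
        rw [← lintegral_map hm (hX.measurable_e i), hX.law_e i]
        exact lintegral_exp_neg_mul_expMeasure_le hθ0
    _ = _ := by
        rw [← ENNReal.ofReal_pow (by positivity), ← ENNReal.ofReal_mul (by positivity)]
        congr 1
        rw [← mul_one (n : ℝ), Real.exp_nat_mul, ← mul_pow, mul_one, hθ, inv_div]
        ring

theorem measure_jumpEvent_le (hX : IsCompoundPoisson P lam e Z X) (hlam : 0 < lam) (n : ℕ) :
    P (jumpEvent lam e n) ≤ ENNReal.ofReal ((lam * Real.exp 1 / n) ^ n) :=
  (measure_mono fun _ hω => hω.1).trans (hX.measure_sum_lt_le hlam n)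

theorem ae_exists_le_sum (hX : IsCompoundPoisson P lam e Z X) (hlam : 0 < lam) :
    ∀ᵐ ω ∂P, ∃ n, lam ≤ ∑ i ∈ Finset.range n, e i ω := by
  rw [ae_iff]
  have hlim : Tendsto (fun n : ℕ => ENNReal.ofReal ((lam * Real.exp 1 / n) ^ n)) atTop (𝓝 0) := by
    rw [← ENNReal.ofReal_zero]
    refine (ENNReal.continuous_ofReal.tendsto 0).comp ?_
    have h1 : Tendsto (fun n : ℕ => lam * Real.exp 1 / (n : ℝ)) atTop (𝓝 0) :=
      tendsto_const_nhds.div_atTop tendsto_natCast_atTop_atTop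
    refine squeeze_zero' (Eventually.of_forall fun n => by positivity) ?_
      (tendsto_pow_atTop_nhds_zero_of_lt_one (r := (1 / 2 : ℝ)) (by norm_num) (by norm_num))
    filter_upwards [h1.eventually_le_const (show (0 : ℝ) < 1 / 2 by norm_num)] with n hn
    gcongr
  refine le_antisymm (ge_of_tendsto' hlim fun n => ?_) zero_le
  refine (measure_mono fun ω hω => ?_).trans (hX.measure_sum_lt_le hlam n)
  by_contra h
  exact hω ⟨n, not_lt.1 h⟩

theorem ae_mem_iUnion_jumpEvent (hX : IsCompoundPoisson P lam e Z X) (hlam : 0 < lam) :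
    ∀ᵐ ω ∂P, ω ∈ ⋃ n, jumpEvent lam e n := by
  filter_upwards [hX.ae_exists_le_sum hlam] with ω hω
  classical
  rw [Set.mem_iUnion]
  have hpos : Nat.find hω ≠ 0 := fun h => by
    have := Nat.find_spec hω
    rw [h, Finset.sum_range_zero] at this
    linarith
  obtain ⟨n, hn⟩ := Nat.exists_eq_succ_of_ne_zero hpos
  refine ⟨n, not_le.1 (Nat.find_min hω (by omega)), ?_⟩
  have := Nat.find_spec hω
  rwa [hn] at this

theorem setLIntegral_jumpEvent (hX : IsCompoundPoisson P lam e Z X) (n i : ℕ) {φ : E → ℝ≥0∞}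
    (hφ : Measurable φ) :
    ∫⁻ ω in jumpEvent lam e n, φ (Z i ω) ∂P =
      P (jumpEvent lam e n) * ∫⁻ ω, φ (Z 0 ω) ∂P := by
  let T : Set (ℕ → ℝ) := {x | ∑ i ∈ Finset.range n, x i < lam ∧
    lam ≤ ∑ i ∈ Finset.range (n + 1), x i}
  have hT : MeasurableSet T := by
    have h : ∀ k, Measurable fun x : ℕ → ℝ => ∑ i ∈ Finset.range k, x i :=
      fun k => Finset.measurable_fun_sum _ fun i _ => measurable_pi_apply i
    exact (measurableSet_lt (h n) measurable_const).inter
      (measurableSet_le measurable_const (h _))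
  have hA := hX.measurableSet_jumpEvent n
  have hg : Measurable fun x : ℕ → E => φ (x i) := hφ.comp (measurable_pi_apply i)
  have hind := hX.indep_e_Z.comp (measurable_one.indicator hT : Measurable (T.indicator 1)) hg
    (γ := ℝ≥0∞)
  have hmul := lintegral_mul_eq_lintegral_mul_lintegral_of_indepFun
    (f := (jumpEvent lam e n).indicator 1) (g := fun ω => φ (Z i ω)) (measurable_one.indicator hA)
    (hφ.comp (hX.measurable_Z i)) hind
  rw [lintegral_indicator_one hA] at hmul
  have hid : ∫⁻ ω, φ (Z i ω) ∂P = ∫⁻ ω, φ (Z 0 ω) ∂P := by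
    rw [← lintegral_map hφ (hX.measurable_Z i), ← lintegral_map hφ (hX.measurable_Z 0),
      (hX.identDistrib_Z i).map_eq]
  rw [← hid, ← hmul, ← lintegral_indicator hA]
  refine lintegral_congr fun ω => ?_
  by_cases hω : ω ∈ jumpEvent lam e n <;> simp [hω]

/-- Quantizing separately on the events of `n ≤ K` jumps, and by the zero path on the rest. -/
theorem exists_codebook [BorelSpace E] [SecondCountableTopology E]
    (hX : IsCompoundPoisson P lam e Z X) (hs : 0 < s) (hlam : 0 < lam) (K : ℕ) {m : ℕ → ℕ}
    (hm : ∀ n, 0 < m n) {C : ℕ → Finset E} (hC : ∀ n, (C n).Nonempty) :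
    ∃ B : Finset (StepPath E), B.Nonempty ∧
      B.card ≤ ∑ n ∈ Finset.range (K + 1), (m n * (C n).card) ^ n ∧
      ∫⁻ ω, ⨅ a ∈ B, pathDist (X ω) a ^ s ∂P ≤
        ∑' n, P (jumpEvent lam e n) * ((2 * n : ℝ≥0∞) ^ s * (n *
          if n ≤ K then (∫⁻ ω, ⨅ z ∈ C n, normDist (Z 0 ω) z ^ s ∂P) +
            (ENNReal.ofReal (1 / m n)) ^ s * ∫⁻ ω, ‖Z 0 ω‖ₑ ^ s ∂P
          else ∫⁻ ω, ‖Z 0 ω‖ₑ ^ s ∂P)) := by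
  classical
  let B := (Finset.range (K + 1)).biUnion fun n => gridCodebook n (m n) (C n)
  -- The zero path already belongs to the codebook for `n = 0`, so it costs no extra codeword.
  have hzero : jumpPath 0 (fun i => ((fun _ => 0 : ℕ → ℕ) i : ℝ) / m 0) (fun _ => (0 : E)) ∈ B :=
    Finset.mem_biUnion.2 ⟨0, by simp, jumpPath_mem_gridCodebook (by simp) (by simp)⟩
  have hφ1 : Measurable fun x : E => ‖x‖ₑ ^ s := measurable_enorm.pow_const s
  have hφ2 : ∀ n, Measurable fun x : E => (⨅ z ∈ C n, normDist x z ^ s) +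
      (ENNReal.ofReal (1 / m n)) ^ s * ‖x‖ₑ ^ s := fun n => by
    refine Measurable.add ?_ (hφ1.const_mul _)
    exact Measurable.biInf _ (C n).countable_toSet fun z _ =>
      ((measurable_id.sub_const z).enorm).pow_const s
  refine ⟨B, ⟨_, hzero⟩, Finset.card_biUnion_le.trans
    (Finset.sum_le_sum fun n _ => card_gridCodebook_le _ _ _), ?_⟩
  -- Restricting to the union of the jump events allows countable subadditivity. The rewriting also
  -- affects `P` on the right-hand side, which is undone afterwards.
  rw [← Measure.restrict_eq_self_of_ae_mem (hX.ae_mem_iUnion_jumpEvent hlam)]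
  refine (lintegral_iUnion_le _ _).trans (ENNReal.tsum_le_tsum fun n => ?_)
  rw [Measure.restrict_eq_self_of_ae_mem (hX.ae_mem_iUnion_jumpEvent hlam)]
  have hA := hX.measurableSet_jumpEvent n
  have hsum : ∀ φ : E → ℝ≥0∞, Measurable φ →
      ∫⁻ ω in jumpEvent lam e n, (2 * n : ℝ≥0∞) ^ s * ∑ i ∈ Finset.range n, φ (Z i ω) ∂P =
      P (jumpEvent lam e n) * ((2 * n : ℝ≥0∞) ^ s * (n * ∫⁻ ω, φ (Z 0 ω) ∂P)) := by
    intro φ hφ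
    have hφZ : ∀ i, Measurable fun ω => φ (Z i ω) := fun i => hφ.comp (hX.measurable_Z i)
    rw [lintegral_const_mul _ (Finset.measurable_fun_sum _ fun i _ => hφZ i),
      lintegral_finsetSum _ fun i _ => hφZ i]
    simp only [hX.setLIntegral_jumpEvent n _ hφ, Finset.sum_const, Finset.card_range,
      nsmul_eq_mul]
    ring
  by_cases hn : n ≤ K
  · have hφZ : Measurable fun ω => ‖Z 0 ω‖ₑ ^ s := hφ1.comp (hX.measurable_Z 0)
    rw [if_pos hn, ← lintegral_const_mul _ hφZ, ← lintegral_add_right _ (hφZ.const_mul _),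
      ← hsum _ (hφ2 n)]
    refine lintegral_mono_ae ((ae_restrict_iff' hA).2 ?_)
    filter_upwards [hX.ae_nonneg, hX.X_eq] with ω h1 h2 hω
    obtain ⟨a, ha, ha'⟩ := exists_mem_gridCodebook hs hlam h1 h2 hω (hm n) (hC n)
    exact (iInf₂_le a (Finset.mem_biUnion.2 ⟨n, by simpa [Nat.lt_succ_iff] using hn, ha⟩)).trans ha'
  · rw [if_neg hn, ← hsum _ hφ1]
    refine lintegral_mono_ae ((ae_restrict_iff' hA).2 ?_)
    filter_upwards [hX.ae_nonneg, hX.X_eq] with ω h1 h2 hω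
    exact (iInf₂_le _ hzero).trans (pathDist_zero_le hs hlam h1 h2 hω _ _)

end IsCompoundPoisson

/-- Codebooks from the quantization dimension. -/
theorem exists_codebook_of_quantDim {Ω E : Type*} [MeasurableSpace Ω]
    [NormedAddCommGroup E] {P : Measure Ω} {s : ℝ} {Y : Ω → E} (hs : 0 < s) {d γ : ℝ}
    (hdim : quantDim P Y normDist s = (d : EReal)) (hγ : d < γ) :
    ∀ᶠ ε : ℝ in 𝓝[>] 0, ∃ C : Finset E, C.Nonempty ∧ (C.card : ℝ) ≤ ε ^ (-γ) ∧
      ∫⁻ ω, ⨅ z ∈ C, normDist (Y ω) z ^ s ∂P ≤ ENNReal.ofReal ((2 * ε) ^ s) := by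
  have hlt : quantDim P Y normDist s < (γ : EReal) := by
    rw [hdim]
    exact_mod_cast hγ
  have hlt1 : ∀ᶠ ε : ℝ in 𝓝[>] 0, ε < 1 :=
    eventually_nhdsWithin_of_eventually_nhds (eventually_lt_nhds one_pos)
  filter_upwards [eventually_lt_of_limsup_lt hlt, hlt1, self_mem_nhdsWithin] with ε hε hε1 hε0
  have hε0' : 0 < ε := hε0
  have hlog : 0 < Real.log (1 / ε) := Real.log_pos (by rw [lt_div_iff₀ hε0']; linarith)
  rw [EReal.div_lt_iff (by exact_mod_cast hlog) (EReal.coe_ne_top _), ← EReal.coe_mul,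
    ← Real.log_exp (γ * _), ← ENNReal.log_ofReal_of_pos (Real.exp_pos _),
    ENNReal.log_lt_log_iff] at hε
  have hexp : Real.exp (γ * Real.log (1 / ε)) = ε ^ (-γ) := by
    rw [Real.rpow_def_of_pos hε0', one_div, Real.log_inv]
    ring_nf
  rw [hexp] at hε
  obtain ⟨n, hn1, hnq, hnε⟩ : ∃ n : ℕ, 1 ≤ n ∧
      quantError P Y normDist s (Real.log n) ≤ ENNReal.ofReal ε ∧
      (n : ℝ≥0∞) < ENNReal.ofReal (ε ^ (-γ)) := by
    have hne : quantNumber P Y normDist s ε ≠ ⊤ := fun h => by simp [h] at hε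
    obtain ⟨k, hk⟩ := ENat.ne_top_iff_exists.1 hne
    have hlt3 : quantNumber P Y normDist s ε < ((k + 1 : ℕ) : ℕ∞) := by
      rw [← hk]
      exact_mod_cast k.lt_succ_self
    simp only [quantNumber, iInf_lt_iff] at hlt3
    obtain ⟨n, hn1, hnq, hnk⟩ := hlt3
    refine ⟨n, hn1, hnq, lt_of_le_of_lt ?_ hε⟩
    rw [← hk, ENat.toENNReal_coe]
    exact_mod_cast Nat.lt_succ_iff.1 (Nat.cast_lt.1 hnk)
  -- The infimum defining the error need not be attained; the factor `2` gives the room to pick an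
  -- actual codebook.
  have hlt2 : quantError P Y normDist s (Real.log n) < ENNReal.ofReal (2 * ε) :=
    hnq.trans_lt ((ENNReal.ofReal_lt_ofReal_iff (by positivity)).2 (by linarith))
  simp only [quantError, iInf_lt_iff] at hlt2
  obtain ⟨C, hC, hCn, hCε⟩ := hlt2
  have hn0 : (0 : ℝ) < n := by exact_mod_cast hn1
  refine ⟨C, hC, ?_, ?_⟩
  · have h1 : (C.card : ℝ) ≤ n :=
      (Real.log_le_log_iff (by exact_mod_cast hC.card_pos) hn0).1 hCn
    have h2 : (n : ℝ) < ε ^ (-γ) := by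
      rwa [← ENNReal.ofReal_natCast, ENNReal.ofReal_lt_ofReal_iff (by positivity)] at hnε
    linarith
  · rw [← ENNReal.ofReal_rpow_of_pos (by positivity)]
    have h := ENNReal.rpow_le_rpow hCε.le hs.le
    rwa [← ENNReal.rpow_mul, one_div, inv_mul_cancel₀ hs.ne', ENNReal.rpow_one] at h

end UpperBound

/-! ### Summing over the number of jumps -/

section UpperBoundRate

/-- The exponent, per unit of `√(r log r)`, in the upper bound for the `s`-th power of the
quantization error. -/
noncomputable def upperExponent (s β η : ℝ) : ℝ := 2 * (s * (1 - η) / (β + η)) * (1 - 2 * η)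

/-- By `(x + y)² ≥ 4xy`, the square of the right side is at least `4 a r log n`, which suffices when
`log n ≥ (1/2 - η) log r`. For smaller `n`, the term `a r / n` alone is at least `a r^(1/2 + η)` and
dominates `√(r log r)`. -/
theorem eventually_le_mul_log_add {a η : ℝ} (ha : 0 < a) (hη : 0 < η) :
    ∀ᶠ r : ℝ in atTop, ∀ n : ℕ, 1 ≤ n →
      √(2 * a * (1 - 2 * η) * (r * Real.log r)) ≤ n * Real.log n + a * r / n := by
  have h1 : ∀ᶠ r : ℝ in atTop, 2 * (1 - 2 * η) * Real.log r ≤ a * r ^ (2 * η) := by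
    have h := (isLittleO_log_rpow_atTop (show 0 < 2 * η by positivity)).tendsto_div_nhds_zero.const_mul
      (2 * (1 - 2 * η))
    rw [mul_zero] at h
    filter_upwards [h.eventually_le_const ha, eventually_gt_atTop 0] with r hr h0
    have h2 : 0 < r ^ (2 * η) := by positivity
    rwa [← mul_div_assoc, div_le_iff₀ h2] at hr
  filter_upwards [h1, eventually_gt_atTop 1] with r hr h0 n hn
  have hL := Real.log_pos h0
  have hn1 : (1 : ℝ) ≤ n := by exact_mod_cast hn
  have hn0 : (0 : ℝ) < n := by linarith
  have hlogn : 0 ≤ Real.log n := Real.log_nonneg hn1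
  have hr0 : 0 < r := by linarith
  refine Real.sqrt_le_iff.2 ⟨by positivity, ?_⟩
  have hsplit : ((n : ℝ) * Real.log n + a * r / n) ^ 2 =
      (n * Real.log n - a * r / n) ^ 2 + 4 * a * r * Real.log n := by
    field_simp
    ring
  rcases le_total ((1 / 2 - η) * Real.log r) (Real.log n) with hc | hc
  · rw [hsplit]
    have := mul_le_mul_of_nonneg_left hc (show 0 ≤ 4 * a * r by positivity)
    nlinarith [sq_nonneg ((n : ℝ) * Real.log n - a * r / n)]
  · have h2 : (n : ℝ) ≤ r ^ (1 / 2 - η) := by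
      rw [← Real.log_le_log_iff hn0 (by positivity), Real.log_rpow hr0]
      exact hc
    have h3 : a * (r ^ (1 / 2 + η)) ≤ a * r / n := by
      rw [le_div_iff₀ hn0, mul_assoc]
      gcongr
      calc r ^ (1 / 2 + η) * n ≤ r ^ (1 / 2 + η) * r ^ (1 / 2 - η) := by gcongr
        _ = r := by
            rw [← Real.rpow_add hr0]
            ring_nf
            exact Real.rpow_one r
    have h4 : (r ^ (1 / 2 + η)) ^ 2 = r * r ^ (2 * η) := by
      rw [← Real.rpow_natCast, ← Real.rpow_mul hr0.le]
      nth_rewrite 2 [← Real.rpow_one r]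
      rw [← Real.rpow_add hr0]
      push_cast
      ring_nf
    calc 2 * a * (1 - 2 * η) * (r * Real.log r) = a * r * (2 * (1 - 2 * η) * Real.log r) := by ring
      _ ≤ a * r * (a * r ^ (2 * η)) := by gcongr
      _ = (a * r ^ (1 / 2 + η)) ^ 2 := by rw [mul_pow, h4]; ring
      _ ≤ _ := by
          gcongr
          have : 0 ≤ (n : ℝ) * Real.log n := by positivity
          linarith

/-- For `K = ⌈√r⌉₊`, `K log K` exceeds `√(r log r)` by a factor of order `√(log r)`, so paths with
more than `K` jumps are negligible. At the same time `K` is small compared with `√(r log r)`, which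
makes factors exponential in `K` harmless. -/
theorem eventually_le_ceil_sqrt_mul_log (a : ℝ) :
    ∀ᶠ r : ℝ in atTop, √(a * (r * Real.log r)) ≤ ⌈√r⌉₊ * Real.log ⌈√r⌉₊ := by
  filter_upwards [Real.tendsto_log_atTop.eventually_ge_atTop (4 * a), eventually_gt_atTop 1]
    with r hr h0
  have hL := Real.log_pos h0
  have hr0 : 0 < r := by linarith
  have hs0 : 0 < √r := Real.sqrt_pos.2 hr0
  have h1 : √r * (Real.log r / 2) ≤ ⌈√r⌉₊ * Real.log ⌈√r⌉₊ := by
    rw [← Real.log_sqrt hr0.le]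
    have h2 : √r ≤ ⌈√r⌉₊ := Nat.le_ceil _
    have h3 : 0 ≤ Real.log √r := by rw [Real.log_sqrt hr0.le]; positivity
    gcongr
  refine le_trans (Real.sqrt_le_iff.2 ⟨by positivity, ?_⟩) h1
  rw [mul_pow, Real.sq_sqrt hr0.le]
  have := mul_le_mul_of_nonneg_left hr (show 0 ≤ r * Real.log r by positivity)
  nlinarith

theorem tendsto_ceil_sqrt_div : Tendsto (fun r : ℝ => (⌈√r⌉₊ : ℝ) / √(r * Real.log r)) atTop (𝓝 0) := by
  have h1 : Tendsto (fun r : ℝ => (⌈√r⌉₊ : ℝ) / √r) atTop (𝓝 1) :=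
    (tendsto_nat_ceil_div_atTop (R := ℝ)).comp Real.tendsto_sqrt_atTop
  have h2 := h1.div_atTop (Real.tendsto_sqrt_atTop.comp Real.tendsto_log_atTop)
  refine h2.congr' ?_
  filter_upwards [eventually_gt_atTop 1] with r hr
  simp only [Function.comp]
  rw [div_div, ← Real.sqrt_mul (by linarith)]

theorem tendsto_ceil_sqrt_div_self : Tendsto (fun r : ℝ => (⌈√r⌉₊ : ℝ) / r) atTop (𝓝 0) := by
  have h1 : Tendsto (fun r : ℝ => (⌈√r⌉₊ : ℝ) / √r) atTop (𝓝 1) :=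
    (tendsto_nat_ceil_div_atTop (R := ℝ)).comp Real.tendsto_sqrt_atTop
  refine (h1.div_atTop Real.tendsto_sqrt_atTop).congr' ?_
  filter_upwards [eventually_gt_atTop 1] with r hr
  rw [div_div, Real.mul_self_sqrt (by linarith)]

/-- Crude bound for the contribution of the paths with `n` jumps. -/
theorem pow_mul_rpow_le {b s w : ℝ} {n : ℕ} (hn : 1 ≤ n) (hb : 0 < b) (hs : 0 < s) (hw : 0 ≤ w) :
    (b / n) ^ n * ((2 * n) ^ s * (n * w)) ≤
      2 ^ s * w * (b * Real.exp (s + 1)) ^ n * Real.exp (-(n * Real.log n)) := by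
  have hn0 : (0 : ℝ) < n := by exact_mod_cast hn
  have h1 : Real.exp (-(n * Real.log n)) = ((n : ℝ) ^ n)⁻¹ := by
    rw [Real.exp_neg, Real.exp_nat_mul, Real.exp_log hn0]
  have h2 : (n : ℝ) ≤ Real.exp n := by linarith [Real.add_one_le_exp (n : ℝ)]
  have h3 : (n : ℝ) ^ s * n ≤ Real.exp (s + 1) ^ n := by
    calc (n : ℝ) ^ s * n ≤ Real.exp n ^ s * Real.exp n := by gcongr
      _ = _ := by
          rw [← Real.exp_mul, ← Real.exp_add, ← Real.exp_nat_mul]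
          ring_nf
  rw [h1, Real.mul_rpow zero_le_two hn0.le, div_pow, mul_pow]
  calc _ = 2 ^ s * w * (b ^ n * (n ^ s * n)) * ((n : ℝ) ^ n)⁻¹ := by ring
    _ ≤ _ := by gcongr

variable {Ω E : Type*} [MeasurableSpace Ω] [NormedAddCommGroup E] [MeasurableSpace E]
  [BorelSpace E] [SecondCountableTopology E] {P : Measure Ω} [IsProbabilityMeasure P]
  {lam s : ℝ} {e : ℕ → Ω → ℝ} {Z : ℕ → Ω → E} {X : Ω → StepPath E}

/-- Every `n ≤ K` receives the same budget `exp ((1 - η) r)`. The reserved factor `exp (η r)` pays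
for the `K + 1` codebooks and the rounding factors `2 ^ K`. The contribution of `n` to the error is
then `exp (-(n log n + a r / n))` up to factors exponential in `n`. -/
theorem eventually_quantError_le {d η : ℝ} (hlam : 0 < lam) (hs : 0 < s) (hd : 0 ≤ d)
    (hη : 0 < η) (hη1 : η < 1) (hX : IsCompoundPoisson P lam e Z X)
    (hdim : quantDim P (Z 0) normDist s = (d : EReal)) :
    ∃ c₁ c₂ : ℝ, ∀ᶠ r : ℝ in atTop, quantError P X pathDist s r ≤
      ENNReal.ofReal (Real.exp
        (-((√(upperExponent s (1 + d) η * (r * Real.log r)) - c₁ * ⌈√r⌉₊ - c₂) / s))) := by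
  set β : ℝ := 1 + d + η with hβ
  have hβ0 : 0 < β := by positivity
  have hη1' : 0 < 1 - η := by linarith
  set a : ℝ := s * (1 - η) / β with ha
  have ha0 : 0 < a := by positivity
  obtain ⟨ε₀, hε₀, hcode⟩ := mem_nhdsGT_iff_exists_Ioo_subset.1
    (exists_codebook_of_quantDim hs hdim (show d < d + η by linarith))
  have hε₀' : (0 : ℝ) < ε₀ := hε₀
  set M : ℝ := (∫⁻ ω, ‖Z 0 ω‖ₑ ^ s ∂P).toReal with hM
  have hM0 : 0 ≤ M := ENNReal.toReal_nonneg
  have hMe : ∫⁻ ω, ‖Z 0 ω‖ₑ ^ s ∂P = ENNReal.ofReal M := by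
    obtain ⟨C, hC, -, hCε⟩ := hcode (show ε₀ / 2 ∈ Set.Ioo 0 ε₀ from
      ⟨by positivity, by linarith⟩)
    exact (ENNReal.ofReal_toReal (lintegral_enorm_rpow_ne_top hs hC hCε)).symm
  -- `2 ^ s` comes from quantizing the heights with error `2 * ε n`, and `M` from the time grid of
  -- mesh at most `ε n`.
  set w : ℝ := 2 ^ s + M with hw
  have hw0 : 0 < w := by positivity
  set b : ℝ := lam * Real.exp 1 with hb
  have hb0 : 0 < b := by positivity
  -- The factor `2` yields a geometric weight `(1 / 2) ^ n` for the sum over `n`. The summand `1`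
  -- ensures `q ≥ 1`, so that `q ^ n ≤ q ^ K` for `n ≤ K`.
  set q : ℝ := 2 * (b * Real.exp (s + 1) + 1) with hq
  have hq1 : 1 ≤ q := by
    have : 0 < b * Real.exp (s + 1) := by positivity
    linarith
  have hbq : b * Real.exp (s + 1) ≤ q * (1 / 2) := by linarith
  clear_value q
  refine ⟨Real.log q, Real.log (2 ^ s * w * 2), ?_⟩
  have hK1 : ∀ᶠ r : ℝ in atTop, 2 * (⌈√r⌉₊ : ℝ) ≤ η * r := by
    filter_upwards [tendsto_ceil_sqrt_div_self.eventually_le_const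
      (show 0 < η / 2 by positivity), eventually_gt_atTop 0] with r hr h0
    rw [div_le_iff₀ h0] at hr
    linarith
  have hK2 : ∀ᶠ r : ℝ in atTop, (-Real.log (min ε₀ 1)) * ⌈√r⌉₊ < (1 - η) / β * r := by
    have h := tendsto_ceil_sqrt_div_self.const_mul (-Real.log (min ε₀ 1))
    rw [mul_zero] at h
    filter_upwards [h.eventually_lt_const (show 0 < (1 - η) / β by positivity),
      eventually_gt_atTop 0] with r hr h0
    rwa [← mul_div_assoc, div_lt_iff₀ h0] at hr
  have hK3 : ∀ᶠ r : ℝ in atTop, q ≤ ⌈√r⌉₊ :=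
    (tendsto_natCast_atTop_atTop.comp
      (tendsto_nat_ceil_atTop.comp Real.tendsto_sqrt_atTop)).eventually_ge_atTop q
  filter_upwards [hK1, hK2, hK3, eventually_le_mul_log_add ha0 hη,
    eventually_le_ceil_sqrt_mul_log (upperExponent s (1 + d) η), eventually_gt_atTop 1]
    with r hr1 hr2 hr3 hr4 hr5 hr
  have hue : upperExponent s (1 + d) η = 2 * a * (1 - 2 * η) := rfl
  rw [← hue] at hr4
  generalize √(upperExponent s (1 + d) η * (r * Real.log r)) = x at *
  generalize ⌈√r⌉₊ = K at *
  have hr0 : 0 < r := by linarith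
  have hK0 : (0 : ℝ) < K := by linarith
  -- Chosen so that `ε n ^ (-β * n) = exp ((1 - η) * r)`, where `β` counts one exponent for the time
  -- and `d + η` for the height of a jump.
  let ε : ℕ → ℝ := fun n => Real.exp (-((1 - η) / β * r / n))
  have hεpos : ∀ n, 0 < ε n := fun n => Real.exp_pos _
  have hεlt : ∀ n, 1 ≤ n → n ≤ K → ε n < min ε₀ 1 := by
    intro n hn hnK
    have hn0 : (0 : ℝ) < n := by exact_mod_cast hn
    rw [← Real.lt_log_iff_exp_lt (by positivity), neg_lt, lt_div_iff₀ hn0]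
    refine lt_of_le_of_lt ?_ hr2
    have : Real.log (min ε₀ 1) ≤ 0 := Real.log_nonpos (by positivity) (min_le_right _ _)
    have hnK' : (n : ℝ) ≤ K := by exact_mod_cast hnK
    exact mul_le_mul_of_nonneg_left hnK' (by linarith)
  have hex : ∀ n, ∃ C : Finset E, C.Nonempty ∧ (1 ≤ n → n ≤ K →
      (C.card : ℝ) ≤ ε n ^ (-(d + η)) ∧
      ∫⁻ ω, ⨅ z ∈ C, normDist (Z 0 ω) z ^ s ∂P ≤ ENNReal.ofReal ((2 * ε n) ^ s)) := by
    intro n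
    by_cases hn : 1 ≤ n ∧ n ≤ K
    · obtain ⟨C, hC, h⟩ := hcode (show ε n ∈ Set.Ioo 0 ε₀ from
        ⟨hεpos n, (hεlt n hn.1 hn.2).trans_le (min_le_left _ _)⟩)
      exact ⟨C, hC, fun _ _ => h⟩
    · exact ⟨{0}, Finset.singleton_nonempty 0, fun h1 h2 => absurd ⟨h1, h2⟩ hn⟩
  choose C hC hCε using hex
  let m : ℕ → ℕ := fun n => ⌈1 / ε n⌉₊
  have hm0 : ∀ n, 0 < m n := fun n => Nat.ceil_pos.2 (one_div_pos.2 (hεpos n))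
  obtain ⟨B, hB, hBcard, hBint⟩ := hX.exists_codebook hs hlam K hm0 hC
  have hBr : Real.log B.card ≤ r := by
    rw [Real.log_le_iff_le_exp (by exact_mod_cast hB.card_pos)]
    have hterm : ∀ n ∈ Finset.range (K + 1), ((m n : ℝ) * (C n).card) ^ n ≤
        2 ^ K * Real.exp ((1 - η) * r) := by
      intro n hn
      have hnK : n ≤ K := Nat.lt_succ_iff.1 (Finset.mem_range.1 hn)
      rcases Nat.eq_zero_or_pos n with rfl | hn1
      · rw [pow_zero]
        exact one_le_mul_of_one_le_of_one_le (one_le_pow₀ one_le_two)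
          (Real.one_le_exp (by positivity))
      · have hn0 : (0 : ℝ) < n := by exact_mod_cast hn1
        have hε1 : ε n ≤ 1 := (hεlt n hn1 hnK).le.trans (min_le_right _ _)
        have hmn : (m n : ℝ) ≤ 2 * ε n ^ (-1 : ℝ) := by
          rw [Real.rpow_neg_one]
          have h1 : (m n : ℝ) < 1 / ε n + 1 :=
            Nat.ceil_lt_add_one (one_div_nonneg.2 (hεpos n).le)
          have h2 : 1 ≤ (ε n)⁻¹ := (one_le_inv₀ (hεpos n)).2 hε1
          rw [one_div] at h1
          linarith
        have hpow : ε n ^ (-1 : ℝ) * ε n ^ (-(d + η)) = Real.exp ((1 - η) * r / n) := by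
          rw [← Real.rpow_add (hεpos n), ← Real.exp_mul]
          congr 1
          rw [show (-1 : ℝ) + -(d + η) = -β by rw [hβ]; ring]
          field_simp
        calc ((m n : ℝ) * (C n).card) ^ n
            ≤ (2 * ε n ^ (-1 : ℝ) * ε n ^ (-(d + η))) ^ n := by
              have h0 : 0 ≤ 2 * ε n ^ (-1 : ℝ) :=
                mul_nonneg zero_le_two (Real.rpow_nonneg (hεpos n).le _)
              exact pow_le_pow_left₀ (mul_nonneg (Nat.cast_nonneg _) (Nat.cast_nonneg _))
                (mul_le_mul hmn (hCε n hn1 hnK).1 (Nat.cast_nonneg _) h0) n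
          _ = 2 ^ n * Real.exp ((1 - η) * r) := by
              rw [mul_assoc, hpow, mul_pow, ← Real.exp_nat_mul]
              rw [mul_div_cancel₀ _ hn0.ne']
          _ ≤ _ := by
              gcongr
              exact one_le_two
    calc (B.card : ℝ) ≤ ∑ n ∈ Finset.range (K + 1), ((m n : ℝ) * (C n).card) ^ n := by
          exact_mod_cast hBcard
      _ ≤ (K + 1) * (2 ^ K * Real.exp ((1 - η) * r)) := by
          refine (Finset.sum_le_card_nsmul _ _ _ hterm).trans_eq ?_
          rw [Finset.card_range, nsmul_eq_mul]
          push_cast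
          rfl
      _ ≤ Real.exp K * (Real.exp K * Real.exp ((1 - η) * r)) := by
          gcongr
          · exact Real.add_one_le_exp _
          · rw [← mul_one (K : ℝ), Real.exp_nat_mul]
            gcongr
            linarith [Real.add_one_le_exp (1 : ℝ)]
      _ ≤ Real.exp r := by
          rw [← Real.exp_add, ← Real.exp_add, Real.exp_le_exp]
          linarith
  have hbound : ∀ n, P (jumpEvent lam e n) * ((2 * n : ℝ≥0∞) ^ s * (n *
      if n ≤ K then (∫⁻ ω, ⨅ z ∈ C n, normDist (Z 0 ω) z ^ s ∂P) +
        (ENNReal.ofReal (1 / m n)) ^ s * ∫⁻ ω, ‖Z 0 ω‖ₑ ^ s ∂P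
      else ∫⁻ ω, ‖Z 0 ω‖ₑ ^ s ∂P)) ≤
      ENNReal.ofReal (2 ^ s * w * (q ^ K * Real.exp (-x))) * 2⁻¹ ^ n := by
    intro n
    rcases Nat.eq_zero_or_pos n with rfl | hn1
    · simp
    have hn0 : (0 : ℝ) < n := by exact_mod_cast hn1
    have hred : ∀ {v : ℝ} {V : ℝ≥0∞}, 0 ≤ v → V ≤ ENNReal.ofReal v →
        2 ^ s * v * (b * Real.exp (s + 1)) ^ n * Real.exp (-(n * Real.log n)) ≤
          2 ^ s * w * (q ^ K * Real.exp (-x)) * (1 / 2) ^ n →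
        P (jumpEvent lam e n) * ((2 * n : ℝ≥0∞) ^ s * (n * V)) ≤
          ENNReal.ofReal (2 ^ s * w * (q ^ K * Real.exp (-x))) * 2⁻¹ ^ n := by
      intro v V hv hV h
      calc P (jumpEvent lam e n) * ((2 * n : ℝ≥0∞) ^ s * (n * V))
          ≤ ENNReal.ofReal ((b / n) ^ n) *
              ((2 * n : ℝ≥0∞) ^ s * (n * ENNReal.ofReal v)) := by
            gcongr
            exact hX.measure_jumpEvent_le hlam n
        _ = ENNReal.ofReal ((b / n) ^ n * ((2 * n) ^ s * (n * v))) := by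
            rw [ENNReal.ofReal_mul (by positivity), ENNReal.ofReal_mul (by positivity),
              ENNReal.ofReal_mul hn0.le, ← ENNReal.ofReal_rpow_of_pos (by positivity),
              ENNReal.ofReal_mul zero_le_two, ENNReal.ofReal_natCast, ENNReal.ofReal_ofNat]
        _ ≤ ENNReal.ofReal (2 ^ s * w * (q ^ K * Real.exp (-x)) * (1 / 2) ^ n) :=
            ENNReal.ofReal_le_ofReal ((pow_mul_rpow_le hn1 hb0 hs hv).trans h)
        _ = _ := by
            rw [ENNReal.ofReal_mul (by positivity), ENNReal.ofReal_pow (by norm_num), one_div,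
              ENNReal.ofReal_inv_of_pos two_pos, ENNReal.ofReal_ofNat]
    have hqn : (b * Real.exp (s + 1)) ^ n ≤ q ^ n * (1 / 2) ^ n := by
      rw [← mul_pow]
      gcongr
    by_cases hnK : n ≤ K
    · rw [if_pos hnK]
      refine hred (v := w * ε n ^ s) (by have := hεpos n; positivity) ?_ ?_
      · rw [hMe, hw, add_mul, ENNReal.ofReal_add (by have := hεpos n; positivity)
          (by have := hεpos n; positivity), ← Real.mul_rpow zero_le_two (hεpos n).le,
          mul_comm M, ENNReal.ofReal_mul (by have := hεpos n; positivity),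
          ← ENNReal.ofReal_rpow_of_pos (hεpos n)]
        gcongr
        · exact (hCε n hn1 hnK).2
        · rw [one_div]
          exact inv_le_of_inv_le₀ (hεpos n) (by rw [← one_div]; exact Nat.le_ceil _)
      · have hεs : ε n ^ s = Real.exp (-(a * r / n)) := by
          rw [← Real.exp_mul, ha]
          congr 1
          ring
        calc 2 ^ s * (w * ε n ^ s) * (b * Real.exp (s + 1)) ^ n * Real.exp (-(n * Real.log n))
            = 2 ^ s * w * (b * Real.exp (s + 1)) ^ n *
                Real.exp (-(n * Real.log n + a * r / n)) := by
              rw [hεs, neg_add, Real.exp_add (-(n * Real.log n))]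
              ring
          _ ≤ 2 ^ s * w * (q ^ n * (1 / 2) ^ n) * Real.exp (-x) := by
              have := hr4 n hn1
              gcongr
          _ ≤ 2 ^ s * w * (q ^ K * (1 / 2) ^ n) * Real.exp (-x) := by
              gcongr
          _ = _ := by ring
    -- In the tail, `q ≤ K < n` gives `(q / n) ^ n ≤ (q / K) ^ K`, and `K log K` is at least `x`.
    · rw [if_neg hnK]
      refine hred hM0 hMe.le ?_
      have hKn : K ≤ n := (not_le.1 hnK).le
      have hKn' : (K : ℝ) ≤ n := by exact_mod_cast hKn
      have hlog : ∀ k : ℕ, (0 : ℝ) < k → Real.exp (-(k * Real.log k)) = ((k : ℝ)⁻¹) ^ k := by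
        intro k hk
        rw [Real.exp_neg, Real.exp_nat_mul, Real.exp_log hk, inv_pow]
      calc 2 ^ s * M * (b * Real.exp (s + 1)) ^ n * Real.exp (-(n * Real.log n))
          ≤ 2 ^ s * w * (q ^ n * (1 / 2) ^ n) * Real.exp (-(n * Real.log n)) := by
            gcongr
            rw [hw]
            linarith [show (0 : ℝ) < 2 ^ s by positivity]
        _ = 2 ^ s * w * (q * (n : ℝ)⁻¹) ^ n * (1 / 2) ^ n := by
            rw [hlog n hn0, mul_pow]
            ring
        _ ≤ 2 ^ s * w * (q * (K : ℝ)⁻¹) ^ n * (1 / 2) ^ n := by gcongr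
        _ ≤ 2 ^ s * w * (q * (K : ℝ)⁻¹) ^ K * (1 / 2) ^ n := by
            have h1 : q * (K : ℝ)⁻¹ ≤ 1 := by rwa [← div_eq_mul_inv, div_le_one hK0]
            have h2 := pow_le_pow_of_le_one (by positivity) h1 hKn
            gcongr
        _ = 2 ^ s * w * (q ^ K * Real.exp (-(K * Real.log K))) * (1 / 2) ^ n := by
            rw [hlog K hK0, mul_pow]
        _ ≤ _ := by gcongr
  have hfinal : ∫⁻ ω, ⨅ a ∈ B, pathDist (X ω) a ^ s ∂P ≤
      ENNReal.ofReal (2 ^ s * w * (q ^ K * Real.exp (-x)) * 2) := by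
    refine hBint.trans ((ENNReal.tsum_le_tsum hbound).trans_eq ?_)
    rw [ENNReal.tsum_mul_left, ENNReal.tsum_geometric, ENNReal.one_sub_inv_two, inv_inv,
      ENNReal.ofReal_mul (by positivity) (q := 2), ENNReal.ofReal_ofNat]
  refine (iInf_le_of_le B (iInf_le_of_le hB (iInf_le_of_le hBr le_rfl))).trans ?_
  refine (ENNReal.rpow_le_rpow hfinal (by positivity)).trans_eq ?_
  rw [ENNReal.ofReal_rpow_of_pos (by positivity)]
  congr 1
  refine Real.log_injOn_pos (Set.mem_Ioi.2 (by positivity)) (Set.mem_Ioi.2 (by positivity)) ?_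
  rw [Real.log_exp, Real.log_rpow (by positivity), mul_right_comm (2 ^ s * w),
    Real.log_mul (x := 2 ^ s * w * 2) (by positivity) (by positivity),
    Real.log_mul (x := q ^ K) (by positivity) (by positivity), Real.log_exp, Real.log_pow]
  ring

end UpperBoundRate

/-! ### The liminf bound and the conclusion -/

section Limit

variable {Ω : Type*} [MeasurableSpace Ω] {P : Measure Ω} [IsProbabilityMeasure P]
  {d : ℕ} {lam s : ℝ} {e : ℕ → Ω → ℝ} {Z : ℕ → Ω → Fin d → ℝ} {X : Ω → StepPath (Fin d → ℝ)}

theorem le_liminf_neg_log_quantError (hlam : 0 < lam) (hs : 0 < s)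
    (hX : IsCompoundPoisson P lam e Z X) (hdim : quantDim P (Z 0) normDist s = (d : EReal)) :
    1 ≤ liminf (fun r : ℝ => -ENNReal.log (quantError P X pathDist s r) /
        ((Real.sqrt (2 / (s * (1 + d)) * (r * Real.log r)) : ℝ) : EReal)) atTop := by
  have hβ : (0 : ℝ) < 1 + d := by positivity
  have hA : 0 < √(2 * s / (1 + d)) := Real.sqrt_pos.2 (by positivity)
  -- For fixed `η` the corrections `c₁ * ⌈√r⌉₊ + c₂` vanish relative to `√(r log r)`. The constant
  -- obtained is continuous in `η` and equals `1` at `η = 0`.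
  have hstep : ∀ η : ℝ, 0 < η → η < 1 / 2 →
      ((√(upperExponent s (1 + d) η) / √(2 * s / (1 + d)) : ℝ) : EReal) ≤
      liminf (fun r : ℝ => -ENNReal.log (quantError P X pathDist s r) /
        ((Real.sqrt (2 / (s * (1 + d)) * (r * Real.log r)) : ℝ) : EReal)) atTop := by
    intro η hη hη1
    obtain ⟨c₁, c₂, hc⟩ := eventually_quantError_le (d := d) hlam hs (Nat.cast_nonneg d) hη
      (by linarith) hX (by exact_mod_cast hdim)
    have hlim : Tendsto (fun r : ℝ => (√(upperExponent s (1 + d) η) -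
        c₁ * ((⌈√r⌉₊ : ℝ) / √(r * Real.log r)) - c₂ / √(r * Real.log r)) / √(2 * s / (1 + d)))
        atTop (𝓝 (√(upperExponent s (1 + d) η) / √(2 * s / (1 + d)))) := by
      have h := ((tendsto_const_nhds (x := √(upperExponent s (1 + d) η)).sub
        (tendsto_ceil_sqrt_div.const_mul c₁)).sub
        ((tendsto_const_nhds (x := c₂)).div_atTop tendsto_sqrt_mul_log_atTop)).div_const
        (√(2 * s / (1 + d)))
      simpa using h
    have hlim' := (continuous_coe_real_ereal.tendsto _).comp hlim
    refine hlim'.liminf_eq.ge.trans (liminf_le_liminf ?_)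
    filter_upwards [hc, tendsto_sqrt_mul_log_atTop.eventually_gt_atTop 0,
      tendsto_mul_log_atTop.eventually_gt_atTop 0] with r hr hQ hQ'
    have h1 : (((√(upperExponent s (1 + d) η * (r * Real.log r)) - c₁ * ⌈√r⌉₊ - c₂) / s : ℝ) :
        EReal) ≤ -ENNReal.log (quantError P X pathDist s r) := by
      rw [EReal.le_neg, ← EReal.coe_neg]
      refine (ENNReal.log_le_log hr).trans_eq ?_
      rw [ENNReal.log_ofReal_of_pos (Real.exp_pos _), Real.log_exp]
    refine le_trans ?_ (EReal.div_le_div_right_of_nonneg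
      (by exact_mod_cast Real.sqrt_nonneg _) h1)
    rw [← EReal.coe_div, sqrt_two_div_mul hs hβ]
    simp only [Function.comp]
    rw [EReal.coe_le_coe_iff]
    apply le_of_eq
    rw [mul_comm (upperExponent s (1 + d) η), Real.sqrt_mul hQ'.le]
    field_simp
  have hcont : Tendsto (fun η : ℝ => √(upperExponent s (1 + d) η) / √(2 * s / (1 + d)))
      (𝓝[>] 0) (𝓝 1) := by
    have h : ContinuousAt (fun η : ℝ => √(upperExponent s (1 + d) η) / √(2 * s / (1 + d))) 0 := by
      unfold upperExponent
      have : (1 + (d : ℝ)) + 0 ≠ 0 := by positivity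
      fun_prop (disch := assumption)
    have h0 : √(upperExponent s (1 + d) 0) / √(2 * s / (1 + d)) = 1 := by
      rw [upperExponent, show 2 * (s * (1 - 0) / (1 + (d : ℝ) + 0)) * (1 - 2 * 0) =
        2 * s / (1 + d) by ring, div_self hA.ne']
    have h' := h.tendsto
    rw [h0] at h'
    exact h'.mono_left nhdsWithin_le_nhds
  have hcont' := (continuous_coe_real_ereal.tendsto (1 : ℝ)).comp hcont
  refine le_of_tendsto hcont' ?_
  filter_upwards [self_mem_nhdsWithin, eventually_nhdsWithin_of_eventually_nhds
    (eventually_lt_nhds (show (0 : ℝ) < 1 / 2 by norm_num))] with η h1 h2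
  exact hstep η h1 h2

end Limit

theorem mainTheorem5 {Ω : Type*} [MeasurableSpace Ω] (P : Measure Ω) [IsProbabilityMeasure P]
    (d : ℕ) (lam s : ℝ) (hlam : 0 < lam) (hs : 0 < s)
    (e : ℕ → Ω → ℝ) (Z : ℕ → Ω → (Fin d → ℝ)) (X : Ω → StepPath (Fin d → ℝ))
    (hX : IsCompoundPoisson P lam e Z X)
    (hac : HasACComponent (P.map (Z 0))) :
    limsup (fun r : ℝ => -ENNReal.log (quantError P X pathDist s r) /
        ((Real.sqrt (2 / (s * (1 + d)) * (r * Real.log r)) : ℝ) : EReal)) atTop ≤ 1 ∧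
    (quantDim P (Z 0) normDist s = (d : EReal) →
      Tendsto (fun r : ℝ => -ENNReal.log (quantError P X pathDist s r) /
        ((Real.sqrt (2 / (s * (1 + d)) * (r * Real.log r)) : ℝ) : EReal)) atTop (𝓝 1)) := by
  have hlimsup := limsup_neg_log_quantError_le hlam hs hX hac
  exact ⟨hlimsup, fun hdim =>
    tendsto_of_le_liminf_of_limsup_le (le_liminf_neg_log_quantError hlam hs hX hdim) hlimsup⟩
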